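/- Let $X=(X(t))_{t\ge 0}$ be a real-valued regenerative process: $X(t)=\xi_k(t-S_{k-1})$ for $t\in[S_{k-1},S_k)$, $k\ge 1$, where $S_0=0$, $S_k=T_1+\dots+T_k$, and $(T_k,\xi_k(\cdot))_{k\ge1}$ are independent copies of a pair $(T,\xi(\cdot))$ with $T>0$ a.s. Put $\bar X(t)=\sup_{0\le s<t}X(s)$, $F(x)=\mathbf P(\bar X(T_1)\le x)$ (the suprema of $\xi_k$ over $[0,T_k)$ being random variables, so that they are part of the i.i.d. structure), $R(x)=-\log(1-F(x))$ and $\alpha_T=\mathbf E T$. For $H:\mathbb R\to\mathbb R$ let $H^{-1}(y)=\inf\{x\in\mathbb R: H(x)>y\}$. Assume that $\alpha_T<\infty$ and that $R=R_0+R_1$ on $\mathbb R$, where $\sup_x|R_1(x)|<\infty$ and $R_0$ satisfies condition $(\mathbb U)$: $R_0(x)\to+\infty$ as $x\to+\infty$; $R_0$ is eventually nondecreasing and differentiable; and, with $r_0=R_0'$, the function $(R_0^{-1}(x))'=1/r_0(R_0^{-1}(x))$ (defined for all large $x$) is regularly varying at $+\infty$ with some index $\kappa\in\mathbb R$, i.e.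 it is positive and measurable near $+\infty$ and has there the form $x^\kappa V(x)$ with $V(tx)/V(t)\to1$ as $t\to+\infty$ for every $x>0$. Let $\{0=t_0<t_1<t_2<\cdots\}$ be a (possibly random) set of times with $t_i\to\infty$ a.s., such that $\mathbf P(S_k\in\{t_0,t_1,\dots\})=1$ for every $k$, and, for every $t\ge0$, $$\sup_{0\le s\le t}X(s)=\max_{i:\,t_i\le t}X(t_i)\quad\text{a.s.}$$ Suppose that $t_n/n\to\alpha$ a.s. as $n\to\infty$ for a constant $\alpha\in(0,\infty)$. Put $\bar X_n=\max_{0\le i\le n}X(t_i)$ and $A(n)=R_0^{-1}\bigl(\log\frac{\alpha n}{\alpha_T}\bigr)$. Then $$\limsup_{n\to\infty}\frac{r_0(A(n))\,(\bar X_n-A(n))}{\log\log n}=1\quad\text{a.s.}\qquad\text{and}\qquad \liminf_{n\to\infty}\frac{r_0(A(n))\,(\bar X_n-A(n))}{\log\log\log n}=-1\quad\text{a.s.}$$ -/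

import Mathlib

open MeasureTheory ProbabilityTheory Filter Topology
open scoped NNReal

noncomputable section

namespace RegenExtremes

/-! ### Regular variation, generalized inverses and condition (U) -/

/-- `V` is slowly varying at `+∞`. -/
def SlowlyVarying (V : ℝ → ℝ) : Prop :=
  ∀ x : ℝ, 0 < x → Tendsto (fun t : ℝ => V (t * x) / V t) atTop (𝓝 1)

/-- `U` is regularly varying at `+∞` with index `κ`: it is positive and measurable in a
neighbourhood `(a, ∞)` of `+∞`, where it has the form `x ^ κ * V x` with `V` slowly varying. -/
def RegularlyVarying (U : ℝ → ℝ) (κ : ℝ) : Prop :=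
  ∃ a : ℝ, 0 ≤ a ∧ (∀ x, a < x → 0 < U x) ∧ Measurable (fun x : Set.Ioi a => U x) ∧
    ∃ V : ℝ → ℝ, SlowlyVarying V ∧ ∀ x, a < x → U x = x ^ κ * V x

/-- The generalized inverse `H⁻¹(y) = inf {x ∈ ℝ : H x > y}`. -/
def genInv (H : ℝ → ℝ) (y : ℝ) : ℝ :=
  sInf {x : ℝ | y < H x}

/-- Condition (U). The derivative `ĥ = (H⁻¹)' = 1 / h(H⁻¹(·))`, `h = H'`, exists near `+∞` and is
regularly varying. -/
structure CondU (H : ℝ → ℝ) : Prop where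
  tendsto_atTop : Tendsto H atTop atTop
  eventually_nice : ∃ x₀ : ℝ, MonotoneOn H (Set.Ici x₀) ∧ ∀ x, x₀ ≤ x → DifferentiableAt ℝ H x
  hasDerivAt_genInv : ∀ᶠ y in atTop, HasDerivAt (genInv H) (1 / deriv H (genInv H y)) y
  regularlyVarying : ∃ κ : ℝ, RegularlyVarying (fun y => 1 / deriv H (genInv H y)) κ

/-! ### Regenerative processes -/

/-- A realization of a regeneration cycle: its duration `T` and a path `ξ : [0, ∞) → ℝ`. -/
structure RegenCycle where
  /-- the duration `T` -/
  length : ℝ≥0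
  /-- the path `ξ` -/
  path : ℝ≥0 → ℝ

namespace RegenCycle

/-- The supremum of the path over `[0, T)`, as an extended real number. -/
def sup (c : RegenCycle) : EReal :=
  ⨆ s : ℝ≥0, ⨆ _ : s < c.length, (c.path s : EReal)

/-- The smallest σ-algebra for which the duration, the coordinates of the path and the supremum of
the path over the cycle are random variables. -/
instance : MeasurableSpace RegenCycle :=
  MeasurableSpace.comap length inferInstance ⊔ MeasurableSpace.comap path inferInstance ⊔
    MeasurableSpace.comap sup inferInstance

end RegenCycle

variable {Ω : Type*}

/-- Regeneration epochs `S k = T₁ + ⋯ + T_k` (`S 0 = 0`); the duration `T_{k+1}` of the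
`(k+1)`-st cycle is written `T k`. -/
def epoch (T : ℕ → Ω → ℝ≥0) (k : ℕ) (ω : Ω) : ℝ≥0 :=
  ∑ i ∈ Finset.range k, T i ω

/-- `X` is the regenerative process built from the cycles `(T k, ξ k)`: the pairs are independent
and identically distributed, the durations are positive, and
`X t = ξ k (t - S k)` for `t ∈ [S k, S (k+1))`. -/
structure IsRegenerative [MeasurableSpace Ω] (μ : Measure Ω) (X : ℝ≥0 → Ω → ℝ)
    (T : ℕ → Ω → ℝ≥0) (ξ : ℕ → Ω → ℝ≥0 → ℝ) : Prop where
  indep : iIndepFun (fun (k : ℕ) (ω : Ω) => RegenCycle.mk (T k ω) (ξ k ω)) μ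
  identDistrib : ∀ k : ℕ, IdentDistrib (fun ω => RegenCycle.mk (T k ω) (ξ k ω))
    (fun ω => RegenCycle.mk (T 0 ω) (ξ 0 ω)) μ μ
  pos : ∀ k : ℕ, ∀ᵐ ω ∂μ, 0 < T k ω
  eq_path : ∀ᵐ ω ∂μ, ∀ (k : ℕ) (t : ℝ≥0), epoch T k ω ≤ t → t < epoch T (k + 1) ω →
    X t ω = ξ k ω (t - epoch T k ω)

/-- The running supremum `X̄ t = sup_{0 ≤ s < t} X s`, as an extended real number. -/
def runningSup (X : ℝ≥0 → Ω → ℝ) (t : ℝ≥0) (ω : Ω) : EReal :=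
  ⨆ s : ℝ≥0, ⨆ _ : s < t, (X s ω : EReal)

/-- The distribution function `F x = P(X̄(T₁) ≤ x)` of the maximum over the first cycle. -/
def cycleMaxCDF [MeasurableSpace Ω] (μ : Measure Ω) (X : ℝ≥0 → Ω → ℝ) (T : ℕ → Ω → ℝ≥0)
    (x : ℝ) : ℝ :=
  μ.real {ω | runningSup X (T 0 ω) ω ≤ (x : EReal)}

/-- `R x = -log (1 - F x)`. -/
def logTail [MeasurableSpace Ω] (μ : Measure Ω) (X : ℝ≥0 → Ω → ℝ) (T : ℕ → Ω → ℝ≥0)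
    (x : ℝ) : ℝ :=
  -Real.log (1 - cycleMaxCDF μ X T x)

/-- The mean duration `α_T = E T` of a cycle. -/
def meanCycle [MeasurableSpace Ω] (μ : Measure Ω) (T : ℕ → Ω → ℝ≥0) : ℝ :=
  ∫ ω, (T 0 ω : ℝ) ∂μ

/-! ### The discrete time set -/

/-- The (possibly random) time set `{0 = t₀ < t₁ < ⋯}`, `t_i → ∞`, contains all regeneration
epochs, and the extreme values of `X` are attained on it: for every `u ≥ 0`, almost surely,
`sup_{0 ≤ s ≤ u} X s = max_{t_i ≤ u} X (t_i)`. -/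
structure AttainsExtremes [MeasurableSpace Ω] (μ : Measure Ω) (X : ℝ≥0 → Ω → ℝ)
    (T : ℕ → Ω → ℝ≥0) (t : ℕ → Ω → ℝ≥0) : Prop where
  zero : ∀ᵐ ω ∂μ, t 0 ω = 0
  strictMono : ∀ᵐ ω ∂μ, StrictMono (fun i => t i ω)
  tendsto : ∀ᵐ ω ∂μ, Tendsto (fun i => t i ω) atTop atTop
  epoch_mem : ∀ k : ℕ, ∀ᵐ ω ∂μ, ∃ i : ℕ, epoch T k ω = t i ω
  sup_eq : ∀ u : ℝ≥0, ∀ᵐ ω ∂μ,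
    (⨆ s : ℝ≥0, ⨆ _ : s ≤ u, (X s ω : EReal)) =
      ⨆ i : ℕ, ⨆ _ : t i ω ≤ u, (X (t i ω) ω : EReal)

/-- `X̄_n = max_{0 ≤ i ≤ n} X (t_i)`. -/
def discreteMax (X : ℝ≥0 → Ω → ℝ) (t : ℕ → Ω → ℝ≥0) (n : ℕ) (ω : Ω) : ℝ :=
  (Finset.range (n + 1)).sup' Finset.nonempty_range_add_one (fun i => X (t i ω) ω)

/-- `L₂ x = log log x`. -/
def L₂ (x : ℝ) : ℝ := Real.log (Real.log x)

/-- `L₃ x = log log log x`. -/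
def L₃ (x : ℝ) : ℝ := Real.log (Real.log (Real.log x))

/-- The centering `A n = R₀⁻¹(log (α n / α_T))`. -/
def centering (R₀ : ℝ → ℝ) (α αT : ℝ) (n : ℕ) : ℝ :=
  genInv R₀ (Real.log (α * n / αT))

/-- `r₀(A n) * (X̄_n - A n)` with `r₀ = R₀'`. -/
def normalizedMax (X : ℝ≥0 → Ω → ℝ) (t : ℕ → Ω → ℝ≥0) (R₀ : ℝ → ℝ) (α αT : ℝ)
    (n : ℕ) (ω : Ω) : ℝ :=
  deriv R₀ (centering R₀ α αT n) * (discreteMax X t n ω - centering R₀ α αT n)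

end RegenExtremes

end

open RegenExtremes

/-! Write g = R₀⁻¹ and h = g' = 1/r₀(g). The maxima over separate cycles are i.i.d., and because R₁
is bounded their tail at level g(y) lies between two constant multiples of e^{-y}
(`IsRegenerative.exists_expTail`). On the y-scale the maximum of k of them therefore behaves like a
maximum of k exponential variables: Borel–Cantelli arguments give the upper level log k + L₂ k and
the lower level log k - L₃ k (the four almost sure statements in `ExpTail`).

By the strong law S_k ~ α_T k, and t_n ~ α n, so the number of cycles completed by t_n is comparable
with n. A constant factor in this number moves log k by O(1), which is negligible against L₂ and L₃.
Hence crude, even dyadic, indices suffice, and `discreteMax_le` and `le_discreteMax` carry the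
bounds from cycle maxima to the discrete maximum.

It remains to leave the y-scale. Regular variation of h gives g(y+v) - g(y) ~ h(y) v for v = o(y),
by uniform convergence for slowly varying functions. With y = log(αn/α_T) and v of order L₂ n or L₃
n, division by h(y), that is, multiplication by r₀(A(n)), turns a level log k + s L(k) into s L(n)
to leading order (`RegularlyVarying.tendsto_increment_log`). -/

namespace RegenExtremes

/-! ### Uniform convergence for slowly varying functions -/

/-- Additive form of the uniform convergence theorem for slowly varying functions. -/
theorem uniform_of_forall_tendsto_sub {f : ℝ → ℝ} (hf : Measurable f)
    (h : ∀ u, Tendsto (fun x => f (x + u) - f x) atTop (𝓝 0)) {ε : ℝ} (hε : 0 < ε) :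
    ∃ X, ∀ x, X ≤ x → ∀ u ∈ Set.Icc (0 : ℝ) 1, |f (x + u) - f x| < ε := by
  -- Pointwise convergence gives convergence in measure on [0,2]. For large x the bad increments
  -- from x, and those from x+u translated by u, each have measure below 1/2, so some m in [1,2] is
  -- good for both; compare f(x) and f(x+u) through f(x+m).
  let ν : Measure ℝ := volume.restrict (Set.Icc 0 2)
  let φ : ℝ → ENNReal := fun x => ν {l | ε / 2 ≤ |f (x + l) - f x|}
  have hmeas : ∀ x, Measurable fun l => f (x + l) - f x := fun x =>
    (hf.comp (measurable_const_add x)).sub_const _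
  have hφ : Tendsto φ atTop (𝓝 0) := by
    refine tendsto_of_seq_tendsto fun x hx => ?_
    have := tendstoInMeasure_of_tendsto_ae (μ := ν) (f := fun n l => f (x n + l) - f (x n))
      (g := fun _ => 0) (fun n => (hmeas _).aestronglyMeasurable)
      (ae_of_all _ fun l => (h l).comp hx)
    rw [tendstoInMeasure_iff_norm] at this
    simpa [φ, Function.comp_def] using this (ε / 2) (by positivity)
  obtain ⟨X, hX⟩ := eventually_atTop.1 (hφ.eventually_lt_const (show (0 : ENNReal) < 1 / 2 by simp))
  refine ⟨X, fun x hx u hu => ?_⟩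
  have h1 := hX x hx
  have h2 := hX (x + u) (by linarith [hu.1])
  let B : Set ℝ := {l | ε / 2 ≤ |f (x + l) - f x|} ∩ Set.Icc 0 2
  let B' : Set ℝ := {l | ε / 2 ≤ |f (x + u + l) - f (x + u)|} ∩ Set.Icc 0 2
  have hB : volume B < 1 / 2 := by
    simpa [φ, ν, B, Measure.restrict_apply (measurableSet_le measurable_const (hmeas x).abs)]
      using h1
  have hB' : volume ((fun l => l + -u) ⁻¹' B') < 1 / 2 := by
    rw [measure_preimage_add_right]
    simpa [φ, ν, B', Measure.restrict_apply (measurableSet_le measurable_const (hmeas (x + u)).abs)]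
      using h2
  have hlt : volume (B ∪ (fun l => l + -u) ⁻¹' B') < volume (Set.Icc (1 : ℝ) 2) := by
    calc _ ≤ volume B + volume ((fun l => l + -u) ⁻¹' B') := measure_union_le _ _
      _ < 1 / 2 + 1 / 2 := ENNReal.add_lt_add hB hB'
      _ = volume (Set.Icc (1 : ℝ) 2) := by
        rw [Real.volume_Icc, ENNReal.add_halves]; norm_num
  obtain ⟨m, hm, hmB⟩ : ∃ m ∈ Set.Icc (1 : ℝ) 2, m ∉ B ∪ (fun l => l + -u) ⁻¹' B' := by
    by_contra! hcon
    exact absurd (measure_mono (μ := volume) hcon) (not_le.2 hlt)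
  rw [Set.mem_union, not_or] at hmB
  have hm1 : |f (x + m) - f x| < ε / 2 := by
    by_contra! hc
    exact hmB.1 ⟨hc, by linarith [hm.1], hm.2⟩
  have hm2 : |f (x + m) - f (x + u)| < ε / 2 := by
    by_contra! hc
    refine hmB.2 ⟨?_, ?_, ?_⟩
    · simpa [show x + u + (m + -u) = x + m by ring] using hc
    · linarith [hm.1, hu.2]
    · linarith [hm.2, hu.1]
  rw [abs_lt] at *
  constructor <;> linarith [hm1.1, hm1.2, hm2.1, hm2.2]

/-- A regularly varying function is asymptotically constant on intervals of small relative
length. -/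
theorem RegularlyVarying.eventually_near {h : ℝ → ℝ} {κ : ℝ} (hh : RegularlyVarying h κ)
    {ε : ℝ} (hε : 0 < ε) :
    ∃ δ > 0, δ < 1 ∧ ∃ Y, 0 < Y ∧ ∀ y, Y ≤ y → 0 < h y ∧
      ∀ z, |z - y| ≤ δ * y → 0 < h z ∧ |h z - h y| ≤ ε * h y := by
  obtain ⟨a, ha, hpos, hmeas, V, hV, hUV⟩ := hh
  classical
  have hVpos : ∀ x, a < x → 0 < V x := fun x hx => by
    have h1 := hpos x hx
    rw [hUV x hx] at h1
    exact (pos_iff_pos_of_mul_pos h1).1 (Real.rpow_pos_of_pos (ha.trans_lt hx) _)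
  have hVexp : ∀ x, a < Real.exp x →
      Real.log (V (Real.exp x)) = Real.log (h (Real.exp x)) - κ * x := fun x hx => by
    rw [hUV _ hx, Real.log_mul (Real.rpow_pos_of_pos (Real.exp_pos _) _).ne' (hVpos _ hx).ne',
      Real.log_rpow (Real.exp_pos _), Real.log_exp]
    ring
  -- h is measurable only on (a, ∞). Extension by zero makes f measurable on ℝ, while f(x) = log
  -- V(e^x) for large x.
  let h' : ℝ → ℝ := fun x => if hx : x ∈ Set.Ioi a then h x else 0
  have hh' : Measurable h' := Measurable.dite hmeas measurable_const measurableSet_Ioi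
  let f : ℝ → ℝ := fun x => Real.log (h' (Real.exp x)) - κ * x
  have hf : Measurable f :=
    (Real.measurable_log.comp (hh'.comp Real.measurable_exp)).sub (measurable_const.mul measurable_id)
  have hfV : ∀ x, a < Real.exp x → f x = Real.log (V (Real.exp x)) := fun x hx => by
    have : h' (Real.exp x) = h (Real.exp x) := dif_pos hx
    rw [hVexp x hx]; simp only [f, this]
  have hflim : ∀ u, Tendsto (fun x => f (x + u) - f x) atTop (𝓝 0) := fun u => by
    have h1 : Tendsto (fun x => Real.log (V (Real.exp x * Real.exp u) / V (Real.exp x))) atTop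
        (𝓝 (Real.log 1)) :=
      ((Real.continuousAt_log one_ne_zero).tendsto.comp (hV _ (Real.exp_pos u))).comp
        Real.tendsto_exp_atTop
    rw [Real.log_one] at h1
    refine h1.congr' ?_
    have e1 := Real.tendsto_exp_atTop.eventually_gt_atTop a
    have e2 := (Real.tendsto_exp_atTop.comp
      (tendsto_atTop_add_const_right atTop u tendsto_id)).eventually_gt_atTop a
    filter_upwards [e1, e2] with x hx1 hx2
    simp only [Function.comp, id] at hx2
    rw [hfV x hx1, hfV _ hx2, ← Real.exp_add, Real.log_div (hVpos _ hx2).ne' (hVpos _ hx1).ne']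
  -- choose the tolerance on the logarithmic scale
  obtain ⟨η, hη, hηε⟩ : ∃ η > 0, ∀ d : ℝ, |d| < η → |Real.exp d - 1| ≤ ε := by
    have := Metric.continuousAt_iff.1 (Real.continuous_exp.continuousAt (x := (0:ℝ))) ε hε
    obtain ⟨η, hη, H⟩ := this
    refine ⟨η, hη, fun d hd => ?_⟩
    have := H (x := d) (by simpa [Real.dist_eq] using hd)
    rw [Real.exp_zero, Real.dist_eq] at this
    exact this.le
  obtain ⟨X, hX⟩ := uniform_of_forall_tendsto_sub hf hflim (show 0 < η / 2 by positivity)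
  -- The increment of log h splits into that of log V and κ times that of log; each gets η/2. The
  -- bound ρ ≤ 1 keeps the logarithmic shift in the interval of uniformity.
  obtain ⟨ρ, hρ, hρ1, hρκ⟩ : ∃ ρ > 0, ρ ≤ 1 ∧ |κ| * ρ < η / 2 := by
    refine ⟨min 1 (η / (4 * (|κ| + 1))), by positivity, min_le_left _ _, ?_⟩
    calc |κ| * min 1 (η / (4 * (|κ| + 1))) ≤ |κ| * (η / (4 * (|κ| + 1))) := by
          gcongr; exact min_le_right _ _
      _ = (η / 4) * (|κ| / (|κ| + 1)) := by field_simp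
      _ ≤ η / 4 * 1 := by
          gcongr; rw [div_le_one (by positivity)]; linarith
      _ < η / 2 := by linarith
  obtain ⟨δ, hδ, hδ1, hδρ⟩ : ∃ δ > 0, δ < 1 / 2 ∧ ∀ q : ℝ, |q - 1| ≤ δ → |Real.log q| ≤ ρ := by
    have := Metric.continuousAt_iff.1 (Real.continuousAt_log one_ne_zero) ρ hρ
    obtain ⟨δ, hδ, H⟩ := this
    refine ⟨min (δ / 2) (1 / 4), by positivity, (min_le_right _ _).trans_lt (by norm_num),
      fun q hq => ?_⟩
    have := H (x := q) (by
      rw [Real.dist_eq]; exact (hq.trans (min_le_left _ _)).trans_lt (by linarith))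
    rw [Real.log_one, Real.dist_eq, sub_zero] at this
    exact this.le
  refine ⟨δ, hδ, by linarith, max (Real.exp (X + 1)) (2 * a + 1), by positivity, fun y hy => ?_⟩
  have hy1 : Real.exp (X + 1) ≤ y := (le_max_left _ _).trans hy
  have hy2 : 2 * a + 1 ≤ y := (le_max_right _ _).trans hy
  have hy0 : 0 < y := (Real.exp_pos _).trans_le hy1
  have hay : a < y := by linarith
  refine ⟨hpos y hay, fun z hz => ?_⟩
  have hz' := abs_le.1 hz
  have hδy : δ * y ≤ 1 / 2 * y := by gcongr
  have haz : a < z := by linarith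
  have hz0 : 0 < z := ha.trans_lt haz
  refine ⟨hpos z haz, ?_⟩
  have hlog : |Real.log z - Real.log y| ≤ ρ := by
    rw [← Real.log_div hz0.ne' hy0.ne']
    apply hδρ
    rw [div_sub_one hy0.ne', abs_div, abs_of_pos hy0, div_le_iff₀ hy0]
    exact hz
  have hXy : X + 1 ≤ Real.log y := (Real.le_log_iff_exp_le hy0).2 hy1
  have hl := abs_le.1 hlog
  have hfd : |f (Real.log z) - f (Real.log y)| < η / 2 := by
    rcases le_total (Real.log y) (Real.log z) with hle | hle
    · have := hX (Real.log y) (by linarith) (Real.log z - Real.log y) ⟨by linarith, by linarith⟩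
      rwa [add_sub_cancel] at this
    · have := hX (Real.log z) (by linarith) (Real.log y - Real.log z) ⟨by linarith, by linarith⟩
      rwa [add_sub_cancel, abs_sub_comm] at this
  have hd : |Real.log (h z) - Real.log (h y)| < η := by
    have ez := hfV (Real.log z) (by rwa [Real.exp_log hz0])
    have ey := hfV (Real.log y) (by rwa [Real.exp_log hy0])
    rw [hVexp _ (by rwa [Real.exp_log hz0]), Real.exp_log hz0] at ez
    rw [hVexp _ (by rwa [Real.exp_log hy0]), Real.exp_log hy0] at ey
    have : Real.log (h z) - Real.log (h y) = (f (Real.log z) - f (Real.log y)) +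
        κ * (Real.log z - Real.log y) := by rw [ez, ey]; ring
    rw [this]
    calc _ ≤ |f (Real.log z) - f (Real.log y)| + |κ| * |Real.log z - Real.log y| := by
          rw [← abs_mul]; exact abs_add_le _ _
      _ ≤ |f (Real.log z) - f (Real.log y)| + |κ| * ρ := by gcongr
      _ < η := by linarith
  have := hηε _ hd
  rw [Real.exp_sub, Real.exp_log (hpos z haz), Real.exp_log (hpos y hay),
    div_sub_one (hpos y hay).ne', abs_div, abs_of_pos (hpos y hay), div_le_iff₀ (hpos y hay)] at this
  exact this

/-- First-order expansion of a function with regularly varying derivative. -/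
theorem RegularlyVarying.tendsto_increment {ι : Type*} {l : Filter ι} {g h : ℝ → ℝ} {κ : ℝ}
    (hh : RegularlyVarying h κ) (hg : ∀ᶠ y in atTop, HasDerivAt g (h y) y) {y v w : ι → ℝ}
    {s : ℝ} (hy : Tendsto y l atTop) (hvy : Tendsto (fun i => v i / y i) l (𝓝 0))
    (hvw : Tendsto (fun i => v i / w i) l (𝓝 s)) :
    Tendsto (fun i => (g (y i + v i) - g (y i)) / h (y i) / w i) l (𝓝 s) := by
  have key : ∀ ε > 0, ∀ᶠ i in l,
      |(g (y i + v i) - g (y i)) / h (y i) / w i - v i / w i| ≤ ε * |v i / w i| := by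
    intro ε hε
    obtain ⟨δ, hδ, hδ1, Y, hY, H⟩ := hh.eventually_near hε
    obtain ⟨Y', hY'⟩ := eventually_atTop.1 hg
    have e1 := hvy.eventually (Metric.ball_mem_nhds 0 hδ)
    have e3 := hy.eventually_ge_atTop (Y' / (1 - δ))
    filter_upwards [e1, hy.eventually_ge_atTop Y, e3] with i hi1 hi2 hi3
    have hypos : 0 < y i := hY.trans_le hi2
    obtain ⟨hhy, Hz⟩ := H _ hi2
    rw [dist_zero_right, Real.norm_eq_abs, abs_div, abs_of_pos hypos,
      div_lt_iff₀ hypos] at hi1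
    rw [div_le_iff₀ (by linarith)] at hi3
    have hball : ∀ z ∈ Metric.closedBall (y i) (δ * y i), |z - y i| ≤ δ * y i := fun z hz => by
      simpa [Real.dist_eq] using hz
    -- Mean value inequality for g(z) - z h(y), whose derivative h(z) - h(y) is at most ε h(y) on
    -- the ball.
    have hbd := (convex_closedBall (y i) (δ * y i)).norm_image_sub_le_of_norm_hasDerivWithin_le
      (f := fun z => g z - z * h (y i)) (f' := fun z => h z - h (y i)) (C := ε * h (y i))
      (x := y i) (y := y i + v i)
      (fun z hz => by
        have hz := abs_le.1 (hball z hz)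
        have := (hY' z (by nlinarith)).sub ((hasDerivAt_id z).mul_const (h (y i)))
        rw [one_mul] at this
        exact this.hasDerivWithinAt)
      (fun z hz => (Hz z (hball z hz)).2)
      (Metric.mem_closedBall_self (by positivity))
      (by simpa [Real.dist_eq] using hi1.le)
    have : |(g (y i + v i) - g (y i)) / h (y i) - v i| ≤ ε * |v i| := by
      rw [div_sub' hhy.ne', abs_div, abs_of_pos hhy, div_le_iff₀ hhy]
      calc _ = ‖g (y i + v i) - (y i + v i) * h (y i) - (g (y i) - y i * h (y i))‖ := by
            rw [Real.norm_eq_abs]; congr 1; ring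
        _ ≤ _ := hbd
        _ = _ := by rw [add_sub_cancel_left, Real.norm_eq_abs]; ring
    rw [← sub_div, abs_div, abs_div, ← mul_div_assoc]
    gcongr
  have hd : Tendsto (fun i => (g (y i + v i) - g (y i)) / h (y i) / w i - v i / w i) l (𝓝 0) := by
    rw [← Asymptotics.isLittleO_one_iff ℝ]
    refine Asymptotics.IsLittleO.trans_isBigO (g := fun i => v i / w i) ?_ (hvw.isBigO_one ℝ)
    rw [Asymptotics.isLittleO_iff]
    exact fun ε hε => key ε hε
  simpa using hd.add hvw

/-! ### Logarithms -/

/-- A bounded difference is negligible against a, so b/a → 1. Iteration shows that L₂ and L₃ do not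
feel constant factors. -/
theorem isBigO_log_sub_log {ι : Type*} {l : Filter ι} {a b : ι → ℝ} (ha : Tendsto a l atTop)
    (hab : (fun i => b i - a i) =O[l] fun _ => (1 : ℝ)) :
    (fun i => Real.log (b i) - Real.log (a i)) =O[l] fun _ => (1 : ℝ) := by
  have h0 : Tendsto (fun i => (b i - a i) / a i) l (𝓝 0) := by
    rw [← Asymptotics.isLittleO_one_iff ℝ]
    have := hab.mul_isLittleO (f₂ := fun i => (a i)⁻¹) (g₂ := fun _ => (1 : ℝ))
      ((Asymptotics.isLittleO_one_iff ℝ).2 (tendsto_inv_atTop_zero.comp ha))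
    simpa [div_eq_mul_inv] using this
  have h1 : Tendsto (fun i => b i / a i) l (𝓝 1) := by
    have := h0.add_const 1
    rw [zero_add] at this
    refine this.congr' ?_
    filter_upwards [ha.eventually_gt_atTop 0] with i hi
    field_simp; ring
  have h2 := ((Real.continuousAt_log one_ne_zero).tendsto.comp h1).isBigO_one ℝ
  refine h2.congr' ?_ EventuallyEq.rfl
  filter_upwards [ha.eventually_gt_atTop 0, h1.eventually_const_lt (show (0 : ℝ) < 1 by norm_num)]
    with i hi hi2
  have hb : 0 < b i := by simpa [hi.ne'] using mul_pos hi2 hi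
  simp [Real.log_div hb.ne' hi.ne']

theorem tendsto_L₂ : Tendsto L₂ atTop atTop := Real.tendsto_log_atTop.comp Real.tendsto_log_atTop

theorem tendsto_L₃ : Tendsto L₃ atTop atTop := Real.tendsto_log_atTop.comp tendsto_L₂

/-- Comparable sequences have logarithms differing by a bounded amount. -/
theorem isBigO_log_sub_log_of_comparable {ι : Type*} {l : Filter ι} {n k : ι → ℝ} {c C : ℝ}
    (hc : 0 < c) (hn : ∀ᶠ i in l, 0 < n i) (h1 : ∀ᶠ i in l, c * n i ≤ k i)
    (h2 : ∀ᶠ i in l, k i ≤ C * n i) :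
    (fun i => Real.log (k i) - Real.log (n i)) =O[l] fun _ => (1 : ℝ) := by
  refine Asymptotics.IsBigO.of_bound (max |Real.log c| |Real.log C|) ?_
  filter_upwards [hn, h1, h2] with i hi h1 h2
  have hk : 0 < k i := (mul_pos hc hi).trans_le h1
  have hC : 0 < C := pos_of_mul_pos_left (hk.trans_le h2) hi.le
  rw [← Real.log_div hk.ne' hi.ne']
  have u1 : Real.log c ≤ Real.log (k i / n i) := Real.log_le_log hc ((le_div_iff₀ hi).2 h1)
  have u2 : Real.log (k i / n i) ≤ Real.log C :=
    Real.log_le_log (by positivity) ((div_le_iff₀ hi).2 h2)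
  simpa using abs_le_max_abs_abs u1 u2

/-- A function `L` such as `L₂` or `L₃`: it tends to infinity, it is negligible with respect to the
logarithm, and it changes by a bounded amount between comparable arguments. -/
structure IsLogScale (L : ℝ → ℝ) : Prop where
  tendsto : Tendsto L atTop atTop
  div_log : Tendsto (fun x => L x / Real.log x) atTop (𝓝 0)
  isBigO : ∀ {a b : ℕ → ℝ}, Tendsto a atTop atTop →
    (fun i => Real.log (b i) - Real.log (a i)) =O[atTop] (fun _ => (1 : ℝ)) →
    (fun i => L (b i) - L (a i)) =O[atTop] fun _ => (1 : ℝ)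

theorem isLogScale_L₂ : IsLogScale L₂ where
  tendsto := tendsto_L₂
  div_log := by
    have := Real.isLittleO_log_id_atTop.tendsto_div_nhds_zero.comp Real.tendsto_log_atTop
    exact this
  isBigO ha hab := isBigO_log_sub_log (Real.tendsto_log_atTop.comp ha) hab

theorem isLogScale_L₃ : IsLogScale L₃ where
  tendsto := tendsto_L₃
  div_log := by
    have h1 := Real.isLittleO_log_id_atTop.tendsto_div_nhds_zero.comp Real.tendsto_log_atTop
    have h2 := Real.isLittleO_log_id_atTop.tendsto_div_nhds_zero.comp tendsto_L₂
    have h3 := h2.mul h1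
    rw [zero_mul] at h3
    refine h3.congr' ?_
    filter_upwards [tendsto_L₂.eventually_gt_atTop 0] with x hx
    simp only [Function.comp, id]
    have : L₃ x = Real.log (L₂ x) := rfl
    rw [this]
    change Real.log (L₂ x) / L₂ x * (L₂ x / _) = _
    field_simp
  isBigO ha hab := isBigO_log_sub_log (tendsto_L₂.comp ha)
    (isBigO_log_sub_log (Real.tendsto_log_atTop.comp ha) hab)

/-- Replacing k by n and inserting the factor b changes the argument of g by O(1), which L(n) → ∞
absorbs; since L = o(log), the shift is small enough for the first-order expansion. -/
theorem RegularlyVarying.tendsto_increment_log {g h L : ℝ → ℝ} {κ : ℝ}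
    (hh : RegularlyVarying h κ) (hg : ∀ᶠ y in atTop, HasDerivAt g (h y) y) (hL : IsLogScale L)
    {n k : ℕ → ℝ} (s : ℝ) {b : ℝ} (hb : 0 < b) (hn : Tendsto n atTop atTop)
    (hnk : (fun i => Real.log (k i) - Real.log (n i)) =O[atTop] fun _ => (1 : ℝ)) :
    Tendsto (fun i => (g (Real.log (k i) + s * L (k i)) - g (Real.log (b * n i))) /
      h (Real.log (b * n i)) / L (n i)) atTop (𝓝 s) := by
  let y : ℕ → ℝ := fun i => Real.log (b * n i)
  let v : ℕ → ℝ := fun i => Real.log (k i) + s * L (k i) - y i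
  have hLn : Tendsto (fun i => L (n i)) atTop atTop := hL.tendsto.comp hn
  have hlog : Tendsto (fun i => Real.log (n i)) atTop atTop := Real.tendsto_log_atTop.comp hn
  have hy : Tendsto y atTop atTop :=
    Real.tendsto_log_atTop.comp (hn.const_mul_atTop hb)
  have hyn : (fun i => y i - Real.log (n i)) =O[atTop] fun _ => (1 : ℝ) :=
    isBigO_log_sub_log_of_comparable hb (hn.eventually_gt_atTop 0) (C := b)
      (Eventually.of_forall fun i => le_rfl) (Eventually.of_forall fun i => le_rfl)
  have hv : (fun i => v i - s * L (n i)) =O[atTop] fun _ => (1 : ℝ) := by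
    have := (hnk.sub hyn).add ((hL.isBigO hn hnk).const_mul_left s)
    refine this.congr_left fun i => ?_
    simp only [v]; ring
  have hvw : Tendsto (fun i => v i / L (n i)) atTop (𝓝 s) := by
    have h0 := (hv.trans_isLittleO ((Asymptotics.isLittleO_const_left (c := (1:ℝ))).2
      (Or.inr (tendsto_norm_atTop_atTop.comp hLn)))).tendsto_div_nhds_zero
    have := h0.add_const s
    rw [zero_add] at this
    refine this.congr' ?_
    filter_upwards [hLn.eventually_gt_atTop 0] with i hi
    field_simp; ring
  have hratio : Tendsto (fun i => Real.log (n i) / y i) atTop (𝓝 1) := by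
    have hny : (fun i => Real.log (n i) - y i) =O[atTop] fun _ => (1 : ℝ) := by
      simpa using hyn.neg_left
    have h0 := (hny.trans_isLittleO ((Asymptotics.isLittleO_const_left (c := (1:ℝ))).2
      (Or.inr (tendsto_norm_atTop_atTop.comp hy)))).tendsto_div_nhds_zero
    have := h0.add_const 1
    rw [zero_add] at this
    refine this.congr' ?_
    filter_upwards [hy.eventually_gt_atTop 0] with i hi
    field_simp; ring
  have hvy : Tendsto (fun i => v i / y i) atTop (𝓝 0) := by
    have := (hvw.mul (hL.div_log.comp hn)).mul hratio
    rw [mul_zero, zero_mul] at this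
    refine this.congr' ?_
    filter_upwards [hLn.eventually_gt_atTop 0, hlog.eventually_gt_atTop 0] with i h1 h2
    simp only [Function.comp]
    field_simp
  have := hh.tendsto_increment hg hy hvy hvw
  refine this.congr fun i => ?_
  simp only [v, y]
  rw [add_sub_cancel]

/-! ### The generalized inverse -/

/-- The last hypothesis confines {H > y} to [x₀, ∞), so its infimum is a point of continuity. There
H ≥ y as a limit of values above y, and H > y would put smaller points in the set. -/
theorem apply_genInv {H : ℝ → ℝ} {x₀ y : ℝ} (hH : Tendsto H atTop atTop)
    (hd : ∀ x, x₀ ≤ x → DifferentiableAt ℝ H x) (hy : ∀ x, x ≤ x₀ → H x ≤ y) :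
    H (genInv H y) = y := by
  have hne : {x : ℝ | y < H x}.Nonempty := (hH.eventually_gt_atTop y).exists
  have hlb : ∀ x ∈ {x : ℝ | y < H x}, x₀ ≤ x := fun x hx => by
    by_contra! hc
    exact absurd (hy x hc.le) (not_le.2 hx)
  have hbdd : BddBelow {x : ℝ | y < H x} := ⟨x₀, hlb⟩
  have hx₀ : x₀ ≤ genInv H y := le_csInf hne hlb
  have hcont := (hd _ hx₀).continuousAt
  apply le_antisymm
  · by_contra! hc
    obtain ⟨z, hz, hzH⟩ : ∃ z < genInv H y, y < H z :=
      (((hcont.eventually_const_lt hc).filter_mono nhdsWithin_le_nhds).and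
        (self_mem_nhdsWithin (s := Set.Iio (genInv H y)))).exists.imp fun z hz => ⟨hz.2, hz.1⟩
    exact absurd (csInf_le hbdd hzH) (not_le.2 hz)
  · have hmem : genInv H y ∈ closure {x : ℝ | y < H x} := csInf_mem_closure hne hbdd
    have := mem_closure_iff_nhdsWithin_neBot.1 hmem
    have hlim : Tendsto H (𝓝[{x : ℝ | y < H x}] genInv H y) (𝓝 (H (genInv H y))) :=
      hcont.tendsto.mono_left nhdsWithin_le_nhds
    exact ge_of_tendsto hlim
      (Filter.mem_of_superset self_mem_nhdsWithin fun z hz => (le_of_lt hz : y ≤ H z))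

theorem IsLogScale.tendsto_log_add {L : ℝ → ℝ} (hL : IsLogScale L) (s : ℝ) :
    Tendsto (fun x => Real.log x + s * L x) atTop atTop := by
  have h1 : Tendsto (fun x => 1 + s * (L x / Real.log x)) atTop (𝓝 (1 + s * 0)) :=
    (hL.div_log.const_mul s).const_add 1
  refine (Real.tendsto_log_atTop.atTop_mul_pos (by norm_num) h1).congr' ?_
  filter_upwards [Real.tendsto_log_atTop.eventually_gt_atTop 0] with x hx
  field_simp

theorem exp_neg_log_add {x : ℝ} (hx : 0 < x) (u : ℝ) :
    Real.exp (-(Real.log x + u)) = Real.exp (-u) / x := by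
  rw [neg_add, Real.exp_add, Real.exp_neg (Real.log x), Real.exp_log hx]
  field_simp

/-! ### Borel–Cantelli lemmas and independence of blocks -/

section BorelCantelli

variable {Ω : Type*} [MeasurableSpace Ω] {μ : Measure Ω}

theorem ae_eventually_notMem_of_le_summable [IsProbabilityMeasure μ] {s : ℕ → Set Ω} {b : ℕ → ℝ} (hb : Summable b)
    (h : ∀ᶠ n in atTop, μ.real (s n) ≤ b n) : ∀ᵐ ω ∂μ, ∀ᶠ n in atTop, ω ∉ s n := by
  have hs : Summable fun n => μ.real (s n) := by
    refine hb.of_norm_bounded_eventually_nat ?_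
    filter_upwards [h] with n hn
    rwa [Real.norm_eq_abs, abs_of_nonneg measureReal_nonneg]
  apply ae_eventually_notMem
  have := hs.tsum_ofReal_ne_top
  simpa using this

theorem ae_frequently_mem_of_not_summable [IsProbabilityMeasure μ] {s : ℕ → Set Ω} {b : ℕ → ℝ}
    (hm : ∀ n, MeasurableSet (s n)) (hi : iIndepSet s μ) (hb : ¬ Summable b)
    (hb0 : ∀ n, 0 ≤ b n) (h : ∀ᶠ n in atTop, b n ≤ μ.real (s n)) :
    ∀ᵐ ω ∂μ, ∃ᶠ n in atTop, ω ∈ s n := by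
  have htop : ∑' n, μ (s n) = ⊤ := by
    by_contra hne
    refine hb ((ENNReal.summable_toReal hne).of_norm_bounded_eventually_nat ?_)
    filter_upwards [h] with n hn
    rwa [Real.norm_eq_abs, abs_of_nonneg (hb0 n)]
  have h1 := measure_limsup_eq_one hm hi htop
  have := (mem_ae_iff_prob_eq_one (MeasurableSet.measurableSet_limsup hm)).2 h1
  filter_upwards [this] with ω hω
  exact mem_limsup_iff_frequently_mem.1 hω

theorem iIndepSet.biInter_of_disjoint {ι κ : Type*} {s : ι → Set Ω}
    (hm : ∀ i, MeasurableSet (s i)) (hs : iIndepSet s μ) {I : κ → Finset ι}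
    (hI : Pairwise (Function.onFun Disjoint I)) : iIndepSet (fun j => ⋂ i ∈ I j, s i) μ := by
  classical
  rw [iIndepSet_iff_meas_biInter fun j => Finset.measurableSet_biInter _ fun i _ => hm i]
  rw [iIndepSet_iff_meas_biInter hm] at hs
  intro F
  rw [← Finset.set_biInter_biUnion, hs, Finset.prod_biUnion fun i _ j _ hij => hI hij]
  exact Finset.prod_congr rfl fun j _ => (hs _).symm

end BorelCantelli

/-! ### Maxima of independent random variables -/

/-- Independent random variables whose tail probabilities at the levels `g y` are comparable with
`exp (-y)`. -/
structure ExpTail {Ω : Type*} [MeasurableSpace Ω] (μ : Measure Ω) (Z : ℕ → Ω → EReal)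
    (g : ℝ → ℝ) : Prop where
  measurable : ∀ i, Measurable (Z i)
  indep : iIndepFun Z μ
  tail : ∃ c C : ℝ, 0 < c ∧ 0 < C ∧ ∀ᶠ y in atTop, ∀ i,
    c * Real.exp (-y) ≤ μ.real {ω | (g y : EReal) < Z i ω} ∧
      μ.real {ω | (g y : EReal) < Z i ω} ≤ C * Real.exp (-y)

namespace ExpTail

variable {Ω : Type*} [MeasurableSpace Ω] {μ : Measure Ω} {Z : ℕ → Ω → EReal} {g : ℝ → ℝ}

theorem measurableSet_gt (hZ : ExpTail μ Z g) (i : ℕ) (x : EReal) :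
    MeasurableSet {ω | x < Z i ω} := measurableSet_lt measurable_const (hZ.measurable i)

theorem measurableSet_le (hZ : ExpTail μ Z g) (i : ℕ) (x : EReal) :
    MeasurableSet {ω | Z i ω ≤ x} := _root_.measurableSet_le (hZ.measurable i) measurable_const

theorem iIndepSet_preimage (hZ : ExpTail μ Z g) {B : ℕ → Set EReal}
    (hB : ∀ i, MeasurableSet (B i)) : iIndepSet (fun i => Z i ⁻¹' B i) μ := by
  rw [iIndepSet_iff_meas_biInter fun i => hZ.measurable i (hB i)]
  exact fun F => hZ.indep.meas_biInter fun i _ => ⟨B i, hB i, rfl⟩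

variable [IsProbabilityMeasure μ]

theorem measureReal_le (hZ : ExpTail μ Z g) (i : ℕ) (x : EReal) :
    μ.real {ω | Z i ω ≤ x} = 1 - μ.real {ω | x < Z i ω} := by
  rw [← probReal_compl_eq_one_sub (hZ.measurableSet_gt i x)]
  congr 1; ext ω; simp

theorem measureReal_biInter_le (hZ : ExpTail μ Z g) (I : Finset ℕ) (x : ℕ → EReal) :
    μ.real (⋂ i ∈ I, {ω | Z i ω ≤ x i}) = ∏ i ∈ I, (1 - μ.real {ω | x i < Z i ω}) := by
  have h := (iIndepSet_iff_meas_biInter fun i => hZ.measurableSet_le i (x i)).1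
    (hZ.iIndepSet_preimage (B := fun i => Set.Iic (x i)) fun i => measurableSet_Iic) I
  rw [Measure.real, h, ENNReal.toReal_prod]
  exact Finset.prod_congr rfl fun i _ => hZ.measureReal_le i (x i)

/-- Union bound: 2^j variables exceed the level with probability at most C (j log 2)^{-(1+δ)}, which
is summable. -/
theorem ae_eventually_forall_le (hZ : ExpTail μ Z g) {δ : ℝ} (hδ : 0 < δ) :
    ∀ᵐ ω ∂μ, ∀ᶠ j : ℕ in atTop, ∀ i < 2 ^ j,
      Z i ω ≤ (g (Real.log (2 ^ j) + (1 + δ) * L₂ (2 ^ j)) : ℝ) := by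
  obtain ⟨c, C, hc, hC, htail⟩ := hZ.tail
  have hpow : Tendsto (fun j : ℕ => (2 : ℝ) ^ j) atTop atTop :=
    tendsto_pow_atTop_atTop_of_one_lt one_lt_two
  have hlev := (isLogScale_L₂.tendsto_log_add (1 + δ)).comp hpow
  have hsum : Summable fun j : ℕ => C * (Real.log 2) ^ (-(1 + δ)) * (j : ℝ) ^ (-(1 + δ)) :=
    (Real.summable_nat_rpow.2 (by linarith)).mul_left _
  have := ae_eventually_notMem_of_le_summable (μ := μ) (s := fun j => ⋃ i ∈ Finset.range (2 ^ j),
    {ω | (g (Real.log (2 ^ j) + (1 + δ) * L₂ (2 ^ j)) : EReal) < Z i ω}) hsum ?_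
  · filter_upwards [this] with ω hω
    filter_upwards [hω] with j hj i hi
    simp only [Set.mem_iUnion, not_exists, Finset.mem_range, Set.mem_ofPred_eq, not_lt] at hj
    exact hj i hi
  · filter_upwards [hlev.eventually htail, eventually_gt_atTop 0] with j hj hj0
    have hj0' : (0 : ℝ) < j := by exact_mod_cast hj0
    refine (measureReal_biUnion_finset_le _ _).trans ?_
    refine (Finset.sum_le_sum fun i _ => (hj i).2).trans ?_
    rw [Finset.sum_const, Finset.card_range, nsmul_eq_mul]
    have hlog2 : 0 < Real.log 2 := Real.log_pos one_lt_two
    have : Real.exp (-((1 + δ) * L₂ (2 ^ j))) =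
        (Real.log 2) ^ (-(1 + δ)) * (j : ℝ) ^ (-(1 + δ)) := by
      rw [← Real.mul_rpow hlog2.le hj0'.le, L₂, Real.log_pow, mul_comm (Real.log 2),
        Real.rpow_def_of_pos (by positivity)]
      congr 1; ring
    simp only [Function.comp]
    rw [exp_neg_log_add (by positivity), this]
    push_cast
    apply le_of_eq
    field_simp

/-- The independent events have probability at least c/(k log k) for large k, a divergent series, so
no δ is needed. -/
theorem ae_frequently_lt (hZ : ExpTail μ Z g) :
    ∀ᵐ ω ∂μ, ∃ᶠ k : ℕ in atTop, ((g (Real.log k + 1 * L₂ k) : ℝ) : EReal) < Z k ω := by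
  obtain ⟨c, C, hc, hC, htail⟩ := hZ.tail
  have hlev := (isLogScale_L₂.tendsto_log_add 1).comp (tendsto_natCast_atTop_atTop (R := ℝ))
  -- The added 1 avoids the default value 1/0 = 0 at k = 1, which would spoil the monotonicity
  -- required for condensation.
  have hns : ¬ Summable fun k : ℕ => 1 / ((k : ℝ) * (1 + Real.log k)) := by
    rw [← summable_condensed_iff_of_nonneg]
    · intro h
      have h2 : Summable fun k : ℕ => 1 / ((k : ℝ) + 1) := by
        refine h.of_nonneg_of_le (fun k => by positivity) fun k => ?_
        have hk : (0 : ℝ) ≤ k := k.cast_nonneg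
        have hl : Real.log 2 ≤ 1 := by linarith [Real.log_two_lt_d9]
        have hl0 : 0 < Real.log 2 := Real.log_pos one_lt_two
        push_cast
        rw [Real.log_pow]
        have : (2 : ℝ) ^ k * (1 / (2 ^ k * (1 + k * Real.log 2))) = 1 / (1 + k * Real.log 2) := by
          field_simp
        rw [this]
        apply one_div_le_one_div_of_le (by positivity)
        nlinarith
      refine Real.not_summable_one_div_natCast ((summable_nat_add_iff 1).1 ?_)
      simpa using h2
    · exact fun k => by have := Real.log_natCast_nonneg k; positivity
    · intro m n hm hmn
      have := Real.log_natCast_nonneg m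
      have hm' : (0 : ℝ) < m := by exact_mod_cast hm
      have hmn' : (m : ℝ) ≤ n := by exact_mod_cast hmn
      gcongr
  refine ae_frequently_mem_of_not_summable
    (s := fun k => {ω | ((g (Real.log k + 1 * L₂ k) : ℝ) : EReal) < Z k ω})
    (fun k => hZ.measurableSet_gt _ _)
    (hZ.iIndepSet_preimage (B := fun k => Set.Ioi _) fun k => measurableSet_Ioi)
    ((summable_mul_left_iff hc.ne').not.2 hns) (fun k => ?_) ?_
  · have := Real.log_natCast_nonneg k; positivity
  · filter_upwards [hlev.eventually htail, (Real.tendsto_log_atTop.comp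
      (tendsto_natCast_atTop_atTop (R := ℝ))).eventually_gt_atTop 0, eventually_gt_atTop 0]
      with k hk hk1 hk0
    have hk0' : (0 : ℝ) < k := by exact_mod_cast hk0
    refine le_trans ?_ (hk k).1
    simp only [Function.comp] at hk1 ⊢
    rw [exp_neg_log_add hk0', one_mul, L₂, Real.exp_neg, Real.exp_log hk1]
    refine mul_le_mul_of_nonneg_left ?_ hc.le
    rw [← one_div, div_div, mul_comm (Real.log k)]
    gcongr
    linarith

/-- By independence all 2^j variables stay below the level with probability at most exp(-c
L₂(2^j)^{1+δ}). As L₂(2^j) ~ log j, this is eventually at most j^{-2}. -/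
theorem ae_eventually_exists_lt (hZ : ExpTail μ Z g) {δ : ℝ} (hδ : 0 < δ) :
    ∀ᵐ ω ∂μ, ∀ᶠ j : ℕ in atTop, ∃ i < 2 ^ j,
      ((g (Real.log (2 ^ j) + -(1 + δ) * L₃ (2 ^ j)) : ℝ) : EReal) < Z i ω := by
  obtain ⟨c, C, hc, hC, htail⟩ := hZ.tail
  have hpow : Tendsto (fun j : ℕ => (2 : ℝ) ^ j) atTop atTop :=
    tendsto_pow_atTop_atTop_of_one_lt one_lt_two
  have hlev := (isLogScale_L₃.tendsto_log_add (-(1 + δ))).comp hpow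
  have hsum : Summable fun j : ℕ => 1 / (j : ℝ) ^ 2 := Real.summable_one_div_nat_pow.2 one_lt_two
  have := ae_eventually_notMem_of_le_summable (μ := μ) (s := fun j => ⋂ i ∈ Finset.range (2 ^ j),
    {ω | Z i ω ≤ ((g (Real.log (2 ^ j) + -(1 + δ) * L₃ (2 ^ j)) : ℝ) : EReal)}) hsum ?_
  · filter_upwards [this] with ω hω
    filter_upwards [hω] with j hj
    simpa using hj
  · have e1 := (tendsto_L₂.comp hpow).eventually_gt_atTop 0
    -- With c e^{δ L₃} ≥ 4 and L₂(2^j) ≥ (log j)/2 the exponent reaches 2 log j.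
    have e2 := (Real.tendsto_exp_atTop.comp
      ((tendsto_L₃.comp hpow).const_mul_atTop hδ)).eventually_ge_atTop (4 / c)
    have e3 := (Real.tendsto_log_atTop.comp
      (tendsto_natCast_atTop_atTop (R := ℝ))).eventually_ge_atTop (-2 * Real.log (Real.log 2))
    filter_upwards [hlev.eventually htail, eventually_gt_atTop 0, e1, e2, e3]
      with j hj hj0 h1 h2 h3
    have hj0' : (0 : ℝ) < j := by exact_mod_cast hj0
    simp only [Function.comp] at hj h1 h2 h3
    rw [hZ.measureReal_biInter_le]
    set p := c * Real.exp (-(Real.log (2 ^ j) + -(1 + δ) * L₃ (2 ^ j))) with hp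
    have hpN : p * 2 ^ j = c * Real.exp (δ * L₃ (2 ^ j)) * L₂ (2 ^ j) := by
      rw [hp, exp_neg_log_add (by positivity), neg_mul, neg_neg, add_mul, Real.exp_add, one_mul]
      have : Real.exp (L₃ (2 ^ j)) = L₂ (2 ^ j) := Real.exp_log h1
      rw [this]; field_simp
    have hL : Real.log j / 2 ≤ L₂ (2 ^ j) := by
      rw [L₂, Real.log_pow, Real.log_mul hj0'.ne' (Real.log_pos one_lt_two).ne']
      linarith
    have hlogj : 0 ≤ Real.log j := Real.log_natCast_nonneg j
    calc _ ≤ ∏ i ∈ Finset.range (2 ^ j), Real.exp (-p) := by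
          refine Finset.prod_le_prod (fun i _ => sub_nonneg.2 measureReal_le_one) fun i _ => ?_
          have := (hj i).1
          have h' := Real.add_one_le_exp (-p)
          linarith
      _ = Real.exp (-(p * 2 ^ j)) := by
          rw [Finset.prod_const, Finset.card_range, ← Real.exp_nat_mul]
          push_cast; congr 1; ring
      _ ≤ Real.exp (-(2 * Real.log j)) := by
          rw [hpN]
          rw [div_le_iff₀ hc] at h2
          apply Real.exp_le_exp.2
          nlinarith
      _ = 1 / (j : ℝ) ^ 2 := by
          have h2 : 2 * Real.log j = Real.log ((j : ℝ) ^ 2) := by rw [Real.log_pow]; norm_num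
          rw [h2, Real.exp_neg, Real.exp_log (by positivity), one_div]

/-- The numbers 2^(j^2) grow so fast that all earlier variables eventually lie below the next level,
while the blocks between consecutive numbers are independent and stay below it with probability at
least 1/(j+1). -/
theorem ae_frequently_forall_le (hZ : ExpTail μ Z g) {δ : ℝ} (hδ : 0 < δ) :
    ∀ᵐ ω ∂μ, ∃ᶠ j : ℕ in atTop, ∀ i < 2 ^ (j ^ 2),
      Z i ω ≤ ((g (Real.log (2 ^ (j ^ 2)) + -(1 - δ) * L₃ (2 ^ (j ^ 2))) : ℝ) : EReal) := by
  obtain ⟨c, C, hc, hC, htail⟩ := hZ.tail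
  let N : ℕ → ℕ := fun j => 2 ^ (j ^ 2)
  -- `lev j` is the level for N(j+1), the right end of block j.
  let lev : ℕ → ℝ := fun j =>
    Real.log (2 ^ ((j + 1) ^ 2)) + -(1 - δ) * L₃ (2 ^ ((j + 1) ^ 2))
  have hpow : Tendsto (fun j : ℕ => (2 : ℝ) ^ ((j + 1) ^ 2)) atTop atTop :=
    (tendsto_pow_atTop_atTop_of_one_lt one_lt_two).comp
      ((tendsto_pow_atTop two_ne_zero).comp (tendsto_add_atTop_nat 1))
  have hlev : Tendsto lev atTop atTop := (isLogScale_L₃.tendsto_log_add (-(1 - δ))).comp hpow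
  -- N(j+1) times the tail bound is C L₂^{1-δ}, and L₂ ≤ 2 log(j+1). The leading factor 2
  -- anticipates 1 - q ≥ e^{-2q} for q ≤ 1/2.
  have hbound : ∀ᶠ j : ℕ in atTop,
      2 * (C * Real.exp (-lev j)) * 2 ^ ((j + 1) ^ 2) ≤ Real.log (j + 1) := by
    have e1 := (tendsto_L₂.comp hpow).eventually_gt_atTop 0
    have e2 := (Real.tendsto_exp_atTop.comp
      ((tendsto_L₃.comp hpow).const_mul_atTop hδ)).eventually_ge_atTop (4 * C)
    filter_upwards [e1, e2] with j h1 h2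
    simp only [Function.comp] at h1 h2
    have h3 : Real.exp (L₃ (2 ^ ((j + 1) ^ 2))) = L₂ (2 ^ ((j + 1) ^ 2)) := Real.exp_log h1
    have h4 : L₂ (2 ^ ((j + 1) ^ 2)) ≤ 2 * Real.log (j + 1) := by
      have hj1 : (0 : ℝ) < j + 1 := by positivity
      have : Real.log (Real.log 2) ≤ 0 :=
        Real.log_nonpos (Real.log_pos one_lt_two).le (by linarith [Real.log_two_lt_d9])
      rw [L₂, Real.log_pow, Real.log_mul (by positivity) (Real.log_pos one_lt_two).ne']
      push_cast
      rw [Real.log_pow]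
      push_cast
      linarith
    have h5 : 2 * (C * Real.exp (-lev j)) * 2 ^ ((j + 1) ^ 2) =
        2 * C * L₂ (2 ^ ((j + 1) ^ 2)) / Real.exp (δ * L₃ (2 ^ ((j + 1) ^ 2))) := by
      simp only [lev]
      rw [exp_neg_log_add (by positivity), ← h3, mul_div_assoc (2 * C), ← Real.exp_sub]
      field_simp
    rw [h5, div_le_iff₀ (Real.exp_pos _)]
    have hlog : 0 ≤ Real.log (j + 1) := Real.log_nonneg (by linarith [j.cast_nonneg (α := ℝ)])
    calc _ ≤ 2 * C * (2 * Real.log (j + 1)) := by gcongr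
      _ = Real.log (j + 1) * (4 * C) := by ring
      _ ≤ _ := by gcongr
  -- the early variables do not exceed the level
  have hearly : ∀ᵐ ω ∂μ, ∀ᶠ j : ℕ in atTop, ∀ i < N j, Z i ω ≤ ((g (lev j) : ℝ) : EReal) := by
    have := ae_eventually_notMem_of_le_summable (μ := μ)
      (s := fun j => ⋃ i ∈ Finset.range (N j), {ω | (g (lev j) : EReal) < Z i ω})
      (b := fun j => (1 / 2 : ℝ) ^ j) summable_geometric_two ?_
    · filter_upwards [this] with ω hω
      filter_upwards [hω] with j hj i hi
      simp only [Set.mem_iUnion, not_exists, Finset.mem_range, Set.mem_ofPred_eq, not_lt] at hj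
      exact hj i hi
    · filter_upwards [hlev.eventually htail, hbound] with j hj hb
      refine (measureReal_biUnion_finset_le _ _).trans ?_
      refine (Finset.sum_le_sum fun i _ => (hj i).2).trans ?_
      rw [Finset.sum_const, Finset.card_range, nsmul_eq_mul]
      have h1 : Real.log (j + 1) ≤ 2 ^ j := by
        have h2 : (j : ℝ) + 1 ≤ 2 ^ j := by exact_mod_cast Nat.succ_le_of_lt j.lt_two_pow_self
        have := Real.log_le_sub_one_of_pos (show (0 : ℝ) < j + 1 by positivity)
        linarith
      have h3 : (2 : ℝ) ^ ((j + 1) ^ 2) = 2 ^ (j ^ 2) * 2 ^ j * 2 ^ j * 2 := by ring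
      have h4 : 2 * (C * Real.exp (-lev j)) * (2 ^ (j ^ 2) * 2 ^ j * 2 ^ j * 2) ≤ 2 ^ j := by
        rw [← h3]; exact hb.trans h1
      simp only [N]
      push_cast
      rw [one_div, inv_pow, ← one_div, le_div_iff₀ (by positivity)]
      have hpos : (0 : ℝ) < 2 ^ j := by positivity
      have hX : 0 ≤ 2 ^ (j ^ 2) * (C * Real.exp (-lev j)) * 2 ^ j := by positivity
      have h5 : (4 * (2 ^ (j ^ 2) * (C * Real.exp (-lev j)) * 2 ^ j)) * 2 ^ j ≤ 1 * 2 ^ j := by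
        linarith
      have := le_of_mul_le_mul_right h5 hpos
      linarith
  -- the blocks are independent
  let I : ℕ → Finset ℕ := fun j => Finset.Ico (N j) (N (j + 1))
  -- β recovers the block from i, so that the event D i depends on i alone and independence applies
  -- to a single family.
  let β : ℕ → ℕ := fun i => Nat.sqrt (Nat.log 2 i)
  have hβ : ∀ j, ∀ i ∈ I j, β i = j := by
    intro j i hi
    obtain ⟨h1, h2⟩ := Finset.mem_Ico.1 hi
    have hi0 : i ≠ 0 := (lt_of_lt_of_le (by positivity) h1).ne'
    have h3 : j ^ 2 ≤ Nat.log 2 i := (Nat.le_log_iff_pow_le one_lt_two hi0).2 h1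
    have h4 : Nat.log 2 i < (j + 1) ^ 2 := (Nat.log_lt_iff_lt_pow one_lt_two hi0).2 h2
    exact le_antisymm (Nat.lt_succ_iff.1 (Nat.sqrt_lt'.2 h4)) (Nat.le_sqrt'.2 h3)
  have hI : Pairwise (Function.onFun Disjoint I) := fun j j' hjj' =>
    Finset.disjoint_left.2 fun i hi hi' => hjj' ((hβ j i hi).symm.trans (hβ j' i hi'))
  let D : ℕ → Set Ω := fun i => {ω | Z i ω ≤ ((g (lev (β i)) : ℝ) : EReal)}
  have hDm : ∀ i, MeasurableSet (D i) := fun i => hZ.measurableSet_le _ _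
  have hDi : iIndepSet D μ :=
    hZ.iIndepSet_preimage (B := fun i => Set.Iic _) fun i => measurableSet_Iic
  have hblock : ∀ᵐ ω ∂μ, ∃ᶠ j in atTop, ω ∈ ⋂ i ∈ I j, D i := by
    refine ae_frequently_mem_of_not_summable (b := fun j : ℕ => 1 / ((j : ℝ) + 1))
      (fun j => Finset.measurableSet_biInter _ fun i _ => hDm i)
      (iIndepSet.biInter_of_disjoint hDm hDi hI) ?_ (fun j => by positivity) ?_
    · intro h
      refine Real.not_summable_one_div_natCast ((summable_nat_add_iff 1).1 ?_)
      simpa using h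
    · filter_upwards [hlev.eventually htail, hbound] with j hj hb
      set q := C * Real.exp (-lev j) with hq
      have hq0 : 0 < q := by positivity
      have hj1 : (0 : ℝ) < j + 1 := by positivity
      have hq2 : q ≤ 1 / 2 := by
        have h1 : (j : ℝ) + 1 ≤ 2 ^ ((j + 1) ^ 2) := by
          have h2 : j + 1 ≤ 2 ^ ((j + 1) ^ 2) :=
            (Nat.le_self_pow two_ne_zero _).trans (Nat.lt_two_pow_self).le
          exact_mod_cast h2
        have h2 := Real.log_le_sub_one_of_pos hj1
        have h3 : (0 : ℝ) < 2 ^ ((j + 1) ^ 2) := by positivity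
        have h4 : (2 * q) * 2 ^ ((j + 1) ^ 2) ≤ 1 * 2 ^ ((j + 1) ^ 2) := by linarith
        linarith [le_of_mul_le_mul_right h4 h3]
      have hexp : Real.exp (-(2 * q)) ≤ 1 - q := by
        rw [Real.exp_neg, inv_le_comm₀ (Real.exp_pos _) (by linarith)]
        refine le_trans ?_ (Real.add_one_le_exp _)
        rw [inv_le_iff_one_le_mul₀ (by linarith)]
        nlinarith
      have hset : (⋂ i ∈ I j, D i) = ⋂ i ∈ I j, {ω | Z i ω ≤ ((g (lev j) : ℝ) : EReal)} := by
        refine Set.iInter₂_congr fun i hi => ?_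
        simp only [D, hβ j i hi]
      rw [hset, hZ.measureReal_biInter_le]
      calc 1 / ((j : ℝ) + 1) = Real.exp (-Real.log (j + 1)) := by
            rw [Real.exp_neg, Real.exp_log hj1, one_div]
        _ ≤ Real.exp (-(2 * q)) ^ (N (j + 1)) := by
            rw [← Real.exp_nat_mul]
            apply Real.exp_le_exp.2
            simp only [N]
            push_cast
            linarith
        _ ≤ Real.exp (-(2 * q)) ^ (I j).card := by
            apply pow_le_pow_of_le_one (Real.exp_pos _).le
            · exact Real.exp_le_one_iff.2 (by linarith)
            · simp [I]
        _ ≤ (1 - q) ^ (I j).card := by gcongr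
        _ = ∏ i ∈ I j, (1 - q) := (Finset.prod_const _).symm
        _ ≤ _ := by
            refine Finset.prod_le_prod (fun i _ => by linarith) fun i _ => ?_
            linarith [(hj i).2]
  filter_upwards [hearly, hblock] with ω h1 h2
  have h3 : ∃ᶠ j : ℕ in atTop, ∀ i < N (j + 1), Z i ω ≤ ((g (lev j) : ℝ) : EReal) := by
    refine (h2.and_eventually h1).mono fun j hj i hi => ?_
    rcases lt_or_ge i (N j) with h | h
    · exact hj.2 i h
    · have hiI : i ∈ I j := Finset.mem_Ico.2 ⟨h, hi⟩
      have := Set.mem_iInter₂.1 hj.1 i hiI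
      simpa only [D, Set.mem_ofPred_eq, hβ j i hiI] using this
  exact (tendsto_add_atTop_nat 1).frequently h3

end ExpTail

/-! ### Upper and lower limits from eventual and frequent bounds -/

theorem limsup_coe_eq {a : ℕ → ℝ} {s : ℝ} (h1 : ∀ r, s < r → ∀ᶠ n in atTop, a n ≤ r)
    (h2 : ∀ r, r < s → ∃ᶠ n in atTop, r ≤ a n) :
    limsup (fun n => (a n : EReal)) atTop = (s : EReal) := by
  apply le_antisymm
  · refine le_of_forall_gt_imp_ge_of_dense fun c hc => ?_
    obtain ⟨r, hr1, hr2⟩ := EReal.lt_iff_exists_real_btwn.1 hc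
    refine le_trans (limsup_le_of_le (by isBoundedDefault) ?_) hr2.le
    filter_upwards [h1 r (EReal.coe_lt_coe_iff.1 hr1)] with n hn
    exact EReal.coe_le_coe_iff.2 hn
  · refine le_of_forall_lt_imp_le_of_dense fun c hc => ?_
    obtain ⟨r, hr1, hr2⟩ := EReal.lt_iff_exists_real_btwn.1 hc
    refine hr1.le.trans (le_limsup_of_frequently_le ?_ (by isBoundedDefault))
    exact (h2 r (EReal.coe_lt_coe_iff.1 hr2)).mono fun n hn => EReal.coe_le_coe_iff.2 hn

theorem liminf_coe_eq {a : ℕ → ℝ} {s : ℝ} (h1 : ∀ r, r < s → ∀ᶠ n in atTop, r ≤ a n)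
    (h2 : ∀ r, s < r → ∃ᶠ n in atTop, a n ≤ r) :
    liminf (fun n => (a n : EReal)) atTop = (s : EReal) := by
  apply le_antisymm
  · refine le_of_forall_gt_imp_ge_of_dense fun c hc => ?_
    obtain ⟨r, hr1, hr2⟩ := EReal.lt_iff_exists_real_btwn.1 hc
    refine le_trans (liminf_le_of_frequently_le ?_ (by isBoundedDefault)) hr2.le
    exact (h2 r (EReal.coe_lt_coe_iff.1 hr1)).mono fun n hn => EReal.coe_le_coe_iff.2 hn
  · refine le_of_forall_lt_imp_le_of_dense fun c hc => ?_
    obtain ⟨r, hr1, hr2⟩ := EReal.lt_iff_exists_real_btwn.1 hc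
    refine hr1.le.trans (le_liminf_of_le (by isBoundedDefault) ?_)
    filter_upwards [h1 r (EReal.coe_lt_coe_iff.1 hr2)] with n hn
    exact EReal.coe_le_coe_iff.2 hn

theorem RegularlyVarying.eventually_pos {h : ℝ → ℝ} {κ : ℝ} (hh : RegularlyVarying h κ) :
    ∀ᶠ y in atTop, 0 < h y := by
  obtain ⟨a, -, ha, -⟩ := hh
  exact (eventually_gt_atTop a).mono ha

/-! ### Transfer of level bounds to the normalized scale -/

section Normalize

variable {g h L : ℝ → ℝ} {κ : ℝ} {n k : ℕ → ℝ} {s b r : ℝ}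

theorem RegularlyVarying.eventually_normalized_le (hh : RegularlyVarying h κ)
    (hg : ∀ᶠ y in atTop, HasDerivAt g (h y) y) (hL : IsLogScale L) (hb : 0 < b)
    (hn : Tendsto n atTop atTop)
    (hnk : (fun i => Real.log (k i) - Real.log (n i)) =O[atTop] fun _ => (1 : ℝ)) (hr : s < r) :
    ∀ᶠ i in atTop, ∀ x ≤ g (Real.log (k i) + s * L (k i)),
      (x - g (Real.log (b * n i))) / h (Real.log (b * n i)) / L (n i) ≤ r := by
  have hy := Real.tendsto_log_atTop.comp (hn.const_mul_atTop hb)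
  filter_upwards [(hh.tendsto_increment_log hg hL s hb hn hnk).eventually_lt_const hr,
    hy.eventually hh.eventually_pos, (hL.tendsto.comp hn).eventually_gt_atTop 0]
    with i h1 h2 h3 x hx
  simp only [Function.comp] at h2 h3
  refine le_trans ?_ h1.le
  gcongr

theorem RegularlyVarying.eventually_le_normalized (hh : RegularlyVarying h κ)
    (hg : ∀ᶠ y in atTop, HasDerivAt g (h y) y) (hL : IsLogScale L) (hb : 0 < b)
    (hn : Tendsto n atTop atTop)
    (hnk : (fun i => Real.log (k i) - Real.log (n i)) =O[atTop] fun _ => (1 : ℝ)) (hr : r < s) :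
    ∀ᶠ i in atTop, ∀ x, g (Real.log (k i) + s * L (k i)) ≤ x →
      r ≤ (x - g (Real.log (b * n i))) / h (Real.log (b * n i)) / L (n i) := by
  have hy := Real.tendsto_log_atTop.comp (hn.const_mul_atTop hb)
  filter_upwards [(hh.tendsto_increment_log hg hL s hb hn hnk).eventually_const_lt hr,
    hy.eventually hh.eventually_pos, (hL.tendsto.comp hn).eventually_gt_atTop 0]
    with i h1 h2 h3 x hx
  simp only [Function.comp] at h2 h3
  refine h1.le.trans ?_
  gcongr

end Normalize

/-! ### Condition (U) and the tail of the cycle maximum -/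

/-- H need not be monotone to the left of x₀, but its distance from the monotone K bounds it there
by K x₀ + C. -/
theorem CondU.apply_genInv {H : ℝ → ℝ} (hH : CondU H) {K : ℝ → ℝ} (hK : Monotone K) {C : ℝ}
    (hC : ∀ x, |K x - H x| ≤ C) : ∀ᶠ y in atTop, H (genInv H y) = y := by
  obtain ⟨x₀, -, hd⟩ := hH.eventually_nice
  filter_upwards [eventually_ge_atTop (K x₀ + C)] with y hy
  refine RegenExtremes.apply_genInv hH.tendsto_atTop hd fun x hx => ?_
  linarith [hK hx, (abs_le.1 (hC x)).1]

namespace RegenCycle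

theorem measurable_length : Measurable length :=
  Measurable.of_comap_le (le_sup_left.trans le_sup_left)

theorem measurable_sup : Measurable sup := Measurable.of_comap_le le_sup_right

end RegenCycle

theorem epoch_succ {Ω : Type*} (T : ℕ → Ω → ℝ≥0) (k : ℕ) (ω : Ω) :
    epoch T (k + 1) ω = epoch T k ω + T k ω := Finset.sum_range_succ _ _

theorem epoch_mono {Ω : Type*} (T : ℕ → Ω → ℝ≥0) (ω : Ω) : Monotone fun k => epoch T k ω :=
  monotone_nat_of_le_succ fun k => by rw [epoch_succ]; exact le_self_add

/-- The maximum over the `k`-th cycle. -/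
noncomputable def cycleMax {Ω : Type*} (T : ℕ → Ω → ℝ≥0) (ξ : ℕ → Ω → ℝ≥0 → ℝ) (k : ℕ) (ω : Ω) : EReal :=
  (RegenCycle.mk (T k ω) (ξ k ω)).sup

section Cycles

variable {Ω : Type*} [MeasurableSpace Ω] {μ : Measure Ω} {X : ℝ≥0 → Ω → ℝ} {T : ℕ → Ω → ℝ≥0}
  {ξ : ℕ → Ω → ℝ≥0 → ℝ}

theorem IsRegenerative.runningSup_ae_eq (hX : IsRegenerative μ X T ξ) :
    ∀ᵐ ω ∂μ, runningSup X (T 0 ω) ω = cycleMax T ξ 0 ω := by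
  filter_upwards [hX.eq_path] with ω hω
  refine iSup_congr fun s => iSup_congr fun hs => ?_
  have := hω 0 s (by simp [epoch]) (by simpa [epoch] using hs)
  rw [this]; simp [epoch]

/-- The tail at R₀⁻¹(y) equals exp(-y - R₁), so the bound C₁ on |R₁| gives the constants e^{±C₁}.
The cycle maxima are only a.e. measurable; Z consists of measurable versions. -/
theorem IsRegenerative.exists_expTail [IsProbabilityMeasure μ] (hX : IsRegenerative μ X T ξ) {R₀ R₁ : ℝ → ℝ}
    (hR : ∀ x : ℝ, logTail μ X T x = R₀ x + R₁ x) (hR₁ : ∃ C₁ : ℝ, ∀ x : ℝ, |R₁ x| ≤ C₁)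
    (hR₀ : CondU R₀) :
    ∃ Z : ℕ → Ω → EReal, ExpTail μ Z (genInv R₀) ∧ ∀ᵐ ω ∂μ, ∀ k, Z k ω = cycleMax T ξ k ω := by
  obtain ⟨C₁, hC₁⟩ := hR₁
  have hid : ∀ k, IdentDistrib (cycleMax T ξ k) (cycleMax T ξ 0) μ μ := fun k =>
    (hX.identDistrib k).comp RegenCycle.measurable_sup
  have hae : ∀ k, AEMeasurable (cycleMax T ξ k) μ := fun k => (hid k).aemeasurable_fst
  let Z : ℕ → Ω → EReal := fun k => (hae k).mk _
  have hZae : ∀ k, cycleMax T ξ k =ᵐ[μ] Z k := fun k => (hae k).ae_eq_mk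
  have hZm : ∀ k, Measurable (Z k) := fun k => (hae k).measurable_mk
  have hind : iIndepFun (cycleMax T ξ) μ :=
    hX.indep.comp (fun _ => RegenCycle.sup) fun _ => RegenCycle.measurable_sup
  let p : ℝ → ℝ := fun x => μ.real {ω | (x : EReal) < Z 0 ω}
  have hp : ∀ k (x : ℝ), μ.real {ω | (x : EReal) < Z k ω} = p x := fun k x => by
    have h1 : IdentDistrib (Z k) (Z 0) μ μ :=
      ((IdentDistrib.of_ae_eq (hae k) (hZae k)).symm.trans (hid k)).trans
        (IdentDistrib.of_ae_eq (hae 0) (hZae 0))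
    exact congrArg ENNReal.toReal (h1.measure_mem_eq (measurableSet_Ioi (a := (x : EReal))))
  have hlogp : ∀ x, logTail μ X T x = -Real.log (p x) := fun x => by
    have h1 : cycleMaxCDF μ X T x = μ.real {ω | Z 0 ω ≤ x} := by
      refine measureReal_congr ?_
      filter_upwards [hX.runningSup_ae_eq, hZae 0] with ω h1 h2
      have : runningSup X (T 0 ω) ω = Z 0 ω := h1.trans h2
      exact congrArg (· ≤ (x : EReal)) this
    have h2 : p x = 1 - μ.real {ω | Z 0 ω ≤ x} := by
      rw [← probReal_compl_eq_one_sub (measurableSet_le (hZm 0) measurable_const)]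
      exact congrArg μ.real (by ext ω; simp)
    rw [logTail, h1, h2]
  have hpanti : Antitone p := fun x y hxy =>
    measureReal_mono fun ω (hω : (y : EReal) < Z 0 ω) =>
      (EReal.coe_le_coe_iff.2 hxy).trans_lt hω
  -- If p vanished at x it would vanish beyond x; then the convention log 0 = 0 gives R = 0 and R₀ =
  -- -R₁ ≤ C₁ there, against R₀ → ∞.
  have hppos : ∀ x, 0 < p x := by
    intro x
    refine lt_of_le_of_ne measureReal_nonneg fun h0 => ?_
    obtain ⟨z, hz1, hz2⟩ :=
      ((hR₀.tendsto_atTop.eventually_gt_atTop C₁).and (eventually_ge_atTop x)).exists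
    have hz : p z = 0 := le_antisymm ((hpanti hz2).trans h0.symm.le) measureReal_nonneg
    have h3 := hlogp z
    rw [hz, Real.log_zero, neg_zero, hR] at h3
    linarith [(abs_le.1 (hC₁ z)).1]
  have hmono : Monotone (logTail μ X T) := fun x y hxy => by
    rw [hlogp, hlogp]
    exact neg_le_neg (Real.log_le_log (hppos y) (hpanti hxy))
  have hinv := hR₀.apply_genInv hmono (C := C₁) fun x => by
    rw [hR, add_sub_cancel_left]; exact hC₁ x
  refine ⟨Z, ⟨hZm, hind.congr hZae, Real.exp (-C₁), Real.exp C₁, Real.exp_pos _, Real.exp_pos _,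
    ?_⟩, ?_⟩
  · filter_upwards [hinv] with y hy i
    have h1 : p (genInv R₀ y) = Real.exp (-(y + R₁ (genInv R₀ y))) := by
      have := hlogp (genInv R₀ y)
      rw [hR, hy] at this
      rw [this, neg_neg, Real.exp_log (hppos _)]
    have h2 := abs_le.1 (hC₁ (genInv R₀ y))
    rw [hp, h1, ← Real.exp_add, ← Real.exp_add]
    constructor <;> apply Real.exp_le_exp.2 <;> linarith
  · rw [ae_all_iff]
    exact fun k => (hZae k).symm

theorem IsRegenerative.meanCycle_pos [IsProbabilityMeasure μ] (hX : IsRegenerative μ X T ξ)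
    (hT : Integrable (fun ω => (T 0 ω : ℝ)) μ) : 0 < meanCycle μ T := by
  rw [meanCycle, integral_pos_iff_support_of_nonneg (fun ω => (T 0 ω).coe_nonneg) hT]
  have : ∀ᵐ ω ∂μ, ω ∈ Function.support fun ω => (T 0 ω : ℝ) := by
    filter_upwards [hX.pos 0] with ω hω
    simpa using hω.ne'
  refine pos_iff_ne_zero.2 fun h0 => ?_
  obtain ⟨ω, h1, h2⟩ := (this.and (measure_eq_zero_iff_ae_notMem.1 h0)).exists
  exact h2 h1

theorem IsRegenerative.tendsto_epoch_div (hX : IsRegenerative μ X T ξ)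
    (hT : Integrable (fun ω => (T 0 ω : ℝ)) μ) :
    ∀ᵐ ω ∂μ, Tendsto (fun k : ℕ => (epoch T k ω : ℝ) / k) atTop (𝓝 (meanCycle μ T)) := by
  have hm : Measurable fun c : RegenCycle => (c.length : ℝ) :=
    measurable_coe_nnreal_real.comp RegenCycle.measurable_length
  have := strong_law_ae_real (μ := μ) (fun k ω => (T k ω : ℝ)) hT
    (fun i j hij => (hX.indep.indepFun hij).comp hm hm)
    (fun i => (hX.identDistrib i).comp hm)
  filter_upwards [this] with ω hω
  simpa [epoch, meanCycle] using hω

end Cycles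

/-! ### Comparison of the discrete maximum with the cycle maxima -/

section Compare

variable {Ω : Type*} {X : ℝ≥0 → Ω → ℝ} {T : ℕ → Ω → ℝ≥0} {ξ : ℕ → Ω → ℝ≥0 → ℝ}
  {t : ℕ → Ω → ℝ≥0} {ω : Ω}

theorem exists_epoch_le_lt {s : ℝ≥0} {k : ℕ} (hs : s < epoch T k ω) :
    ∃ j < k, epoch T j ω ≤ s ∧ s < epoch T (j + 1) ω := by
  induction k with
  | zero => simp [epoch] at hs
  | succ k ih =>
    rcases lt_or_ge s (epoch T k ω) with h | h
    · obtain ⟨j, hj, h'⟩ := ih h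
      exact ⟨j, hj.trans k.lt_succ_self, h'⟩
    · exact ⟨k, k.lt_succ_self, h, hs⟩

theorem discreteMax_le
    (hpath : ∀ (k : ℕ) (s : ℝ≥0), epoch T k ω ≤ s → s < epoch T (k + 1) ω →
      X s ω = ξ k ω (s - epoch T k ω))
    (ht : StrictMono fun i => t i ω) {n k : ℕ} (hnk : t n ω < epoch T k ω) {x : ℝ}
    (hx : ∀ i < k, cycleMax T ξ i ω ≤ x) : discreteMax X t n ω ≤ x := by
  refine Finset.sup'_le _ _ fun i hi => ?_
  have hin : t i ω ≤ t n ω := ht.monotone (Nat.lt_succ_iff.1 (Finset.mem_range.1 hi))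
  obtain ⟨j, hj, h1, h2⟩ := exists_epoch_le_lt (hin.trans_lt hnk)
  rw [hpath j _ h1 h2, ← EReal.coe_le_coe_iff]
  refine le_trans ?_ (hx j hj)
  refine le_iSup₂ (f := fun (s : ℝ≥0) (_ : s < T j ω) => (ξ j ω s : EReal)) _ ?_
  rw [epoch_succ] at h2
  exact (tsub_lt_iff_left h1).2 h2

theorem le_discreteMax
    (hpath : ∀ (k : ℕ) (s : ℝ≥0), epoch T k ω ≤ s → s < epoch T (k + 1) ω →
      X s ω = ξ k ω (s - epoch T k ω))
    (ht : StrictMono fun i => t i ω)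
    (hsup : ∀ q : ℚ, (⨆ s : ℝ≥0, ⨆ _ : s ≤ Real.toNNReal q, (X s ω : EReal)) =
      ⨆ i : ℕ, ⨆ _ : t i ω ≤ Real.toNNReal q, (X (t i ω) ω : EReal))
    {n k i : ℕ} (hnk : epoch T k ω ≤ t n ω) (hik : i < k) {x : ℝ}
    (hx : (x : EReal) < cycleMax T ξ i ω) : x ≤ discreteMax X t n ω := by
  obtain ⟨s, hs⟩ := lt_iSup_iff.1 hx
  obtain ⟨hsT, hs⟩ := lt_iSup_iff.1 hs
  have h1 : epoch T i ω + s < epoch T (i + 1) ω := by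
    rw [epoch_succ]; exact (add_lt_add_iff_left _).2 hsT
  have hXs : X (epoch T i ω + s) ω = ξ i ω s := by
    rw [hpath i _ le_self_add h1, add_tsub_cancel_left]
  -- The supremum identity holds off a null set depending on the time, so it is used only at
  -- rational times; one fits between the chosen point and the end of its cycle.
  obtain ⟨q, -, hq1, hq2⟩ := (NNReal.lt_iff_exists_rat_btwn _ _).1 h1
  have hqn : Real.toNNReal q < t n ω := hq2.trans_le ((epoch_mono T ω hik).trans hnk)
  have h2 : (ξ i ω s : EReal) ≤ (discreteMax X t n ω : EReal) := by
    rw [← hXs]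
    refine (le_iSup₂ (f := fun (u : ℝ≥0) (_ : u ≤ Real.toNNReal q) => (X u ω : EReal))
      (epoch T i ω + s) hq1.le).trans ?_
    rw [hsup q]
    refine iSup₂_le fun m hm => EReal.coe_le_coe_iff.2 ?_
    have hmn : m < n := ht.lt_iff_lt.1 (hm.trans_lt hqn)
    exact Finset.le_sup' (fun i => X (t i ω) ω) (Finset.mem_range.2 (by omega))
  exact EReal.coe_le_coe_iff.1 (hs.le.trans h2)

end Compare

/-! ### Index sequences -/

theorem eventually_linear_bounds {a : ℕ → ℝ} {c : ℝ} (hc : 0 < c)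
    (h : Tendsto (fun n : ℕ => a n / n) atTop (𝓝 c)) :
    ∀ᶠ n : ℕ in atTop, c / 2 * n ≤ a n ∧ a n ≤ 2 * c * n := by
  filter_upwards [h.eventually_const_lt (show c / 2 < c by linarith),
    h.eventually_lt_const (show c < 2 * c by linarith), eventually_gt_atTop 0] with n h1 h2 hn
  have hn' : (0 : ℝ) < n := by exact_mod_cast hn
  exact ⟨((lt_div_iff₀ hn').1 h1).le, ((div_lt_iff₀ hn').1 h2).le⟩

theorem tendsto_natLog_two : Tendsto (Nat.log 2) atTop atTop :=
  tendsto_atTop_atTop.2 fun b =>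
    ⟨2 ^ b, fun _ hn => Nat.le_log_of_pow_le one_lt_two hn⟩

theorem two_pow_log_bounds {n : ℕ} (hn : 0 < n) :
    (2 : ℝ) ^ Nat.log 2 n ≤ n ∧ (n : ℝ) ≤ 2 * 2 ^ Nat.log 2 n := by
  constructor
  · exact_mod_cast Nat.pow_log_le_self 2 hn.ne'
  · have := (Nat.lt_pow_succ_log_self one_lt_two n).le
    rw [pow_succ, mul_comm] at this
    exact_mod_cast this

section Indices

variable {S t : ℕ → ℝ} {A α : ℝ}

/-- There are dyadic numbers of cycles, comparable with `n`, that are not completed at time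
`t n`. -/
theorem exists_dyadic_gt (hA : 0 < A) (hα : 0 < α)
    (hS : Tendsto (fun k : ℕ => S k / k) atTop (𝓝 A))
    (ht : Tendsto (fun n : ℕ => t n / n) atTop (𝓝 α)) :
    ∃ j : ℕ → ℕ, Tendsto j atTop atTop ∧
      (fun n : ℕ => Real.log (2 ^ j n) - Real.log n) =O[atTop] (fun _ => (1 : ℝ)) ∧
      ∀ᶠ n in atTop, t n < S (2 ^ j n) := by
  -- The 8 collects t n ≤ 2αn, S k ≥ Ak/2, and a factor 2 from rounding n down to a power of 2.
  obtain ⟨J, hJ⟩ := pow_unbounded_of_one_lt (8 * α / A) one_lt_two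
  rw [div_lt_iff₀ hA] at hJ
  have hj : Tendsto (fun n => Nat.log 2 n + J) atTop atTop :=
    (tendsto_add_atTop_nat J).comp tendsto_natLog_two
  refine ⟨fun n => Nat.log 2 n + J, hj, ?_, ?_⟩
  · refine isBigO_log_sub_log_of_comparable (c := 2 ^ J / 2) (C := 2 ^ J) (by positivity)
      ?_ ?_ ?_ <;> filter_upwards [eventually_gt_atTop 0] with n hn
    · exact_mod_cast hn
    · rw [pow_add]; nlinarith [two_pow_log_bounds hn, pow_pos (two_pos (α := ℝ)) J]
    · rw [pow_add]; nlinarith [two_pow_log_bounds hn, pow_pos (two_pos (α := ℝ)) J]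
  · have hpow : Tendsto (fun n => 2 ^ (Nat.log 2 n + J)) atTop atTop :=
      (tendsto_pow_atTop_atTop_of_one_lt (one_lt_two (α := ℕ))).comp hj
    filter_upwards [hpow.eventually (eventually_linear_bounds hA hS),
      eventually_linear_bounds hα ht, eventually_gt_atTop 0] with n h1 h2 hn
    have h3 := (two_pow_log_bounds hn).2
    have hn' : (0 : ℝ) < n := by exact_mod_cast hn
    have h4 := h1.1
    push_cast at h4
    rw [pow_add] at h4
    refine lt_of_lt_of_le ?_ h4
    calc t n ≤ 2 * α * n := h2.2
      _ = (8 * α) * (n / 4) := by ring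
      _ < (2 ^ J * A) * (n / 4) := by gcongr
      _ ≤ (2 ^ J * A) * (2 * 2 ^ Nat.log 2 n / 4) := by gcongr
      _ = _ := by ring

/-- There are dyadic numbers of cycles, comparable with `n`, that are completed at time `t n`. -/
theorem exists_dyadic_le (hA : 0 < A) (hα : 0 < α)
    (hS : Tendsto (fun k : ℕ => S k / k) atTop (𝓝 A))
    (ht : Tendsto (fun n : ℕ => t n / n) atTop (𝓝 α)) :
    ∃ j : ℕ → ℕ, Tendsto j atTop atTop ∧
      (fun n : ℕ => Real.log (2 ^ j n) - Real.log n) =O[atTop] (fun _ => (1 : ℝ)) ∧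
      ∀ᶠ n in atTop, S (2 ^ j n) ≤ t n := by
  obtain ⟨J, hJ⟩ := pow_unbounded_of_one_lt (4 * A / α) one_lt_two
  rw [div_lt_iff₀ hα] at hJ
  have hj : Tendsto (fun n => Nat.log 2 n - J) atTop atTop :=
    (tendsto_sub_atTop_nat J).comp tendsto_natLog_two
  have hsplit : ∀ᶠ n : ℕ in atTop, (2 : ℝ) ^ (Nat.log 2 n - J) * 2 ^ J = 2 ^ Nat.log 2 n := by
    filter_upwards [tendsto_natLog_two.eventually_ge_atTop J] with n hn
    rw [← pow_add, Nat.sub_add_cancel hn]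
  refine ⟨fun n => Nat.log 2 n - J, hj, ?_, ?_⟩
  · refine isBigO_log_sub_log_of_comparable (c := 1 / (2 * 2 ^ J)) (C := 1) (by positivity)
      ?_ ?_ ?_ <;> filter_upwards [eventually_gt_atTop 0, hsplit] with n hn h
    · exact_mod_cast hn
    · rw [one_div, inv_mul_le_iff₀ (by positivity)]
      linarith [two_pow_log_bounds hn]
    · rw [one_mul]
      refine le_trans ?_ (two_pow_log_bounds hn).1
      rw [← h]
      exact le_mul_of_one_le_right (by positivity) (one_le_pow₀ one_le_two)
  · have hpow : Tendsto (fun n => 2 ^ (Nat.log 2 n - J)) atTop atTop :=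
      (tendsto_pow_atTop_atTop_of_one_lt (one_lt_two (α := ℕ))).comp hj
    filter_upwards [hpow.eventually (eventually_linear_bounds hA hS),
      eventually_linear_bounds hα ht, eventually_gt_atTop 0, hsplit] with n h1 h2 hn h
    have h3 := (two_pow_log_bounds hn).1
    have h4 := h1.2
    push_cast at h4
    refine h4.trans (le_trans ?_ h2.1)
    calc 2 * A * 2 ^ (Nat.log 2 n - J) = (4 * A) * (2 ^ (Nat.log 2 n - J) / 2) := by ring
      _ ≤ (2 ^ J * α) * (2 ^ (Nat.log 2 n - J) / 2) := by gcongr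
      _ = α / 2 * 2 ^ Nat.log 2 n := by rw [← h]; ring
      _ ≤ _ := by gcongr

/-- The first `k + 1` cycles are completed at time `t n`, for some `n` comparable with `k`. -/
theorem exists_index_ge (hA : 0 < A) (hα : 0 < α)
    (hS : Tendsto (fun k : ℕ => S k / k) atTop (𝓝 A))
    (ht : Tendsto (fun n : ℕ => t n / n) atTop (𝓝 α)) :
    ∃ n : ℕ → ℕ, Tendsto n atTop atTop ∧
      (fun k : ℕ => Real.log k - Real.log (n k)) =O[atTop] (fun _ => (1 : ℝ)) ∧
      ∀ᶠ k in atTop, S (k + 1) ≤ t (n k) := by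
  obtain ⟨D, hD⟩ := exists_nat_gt (4 * A / α)
  rw [div_lt_iff₀ hα] at hD
  have hD0 : 0 < (D : ℝ) := pos_of_mul_pos_left ((mul_pos four_pos hA).trans hD) hα.le
  have hD1 : 1 ≤ D := by exact_mod_cast hD0
  have hD1' : (1 : ℝ) ≤ D := by exact_mod_cast hD1
  have hn : Tendsto (fun k => D * (k + 1)) atTop atTop :=
    tendsto_atTop_mono (fun k => k.le_succ.trans (Nat.le_mul_of_pos_left _ hD1)) tendsto_id
  refine ⟨fun k => D * (k + 1), hn, ?_, ?_⟩
  · refine isBigO_log_sub_log_of_comparable (c := 1 / (2 * D)) (C := 1) (by positivity)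
      ?_ ?_ ?_ <;> filter_upwards [eventually_ge_atTop 1] with k hk <;>
      have hk' : (1 : ℝ) ≤ k := by exact_mod_cast hk
    · positivity
    · rw [one_div, inv_mul_le_iff₀ (by positivity)]
      push_cast; nlinarith
    · push_cast; nlinarith
  · filter_upwards [(tendsto_add_atTop_nat 1).eventually (eventually_linear_bounds hA hS),
      hn.eventually (eventually_linear_bounds hα ht)] with k h1 h2
    refine h1.2.trans (le_trans ?_ h2.1)
    push_cast
    have : (0 : ℝ) ≤ (k : ℝ) + 1 := by positivity
    nlinarith

/-- At time `t n`, for some `n` comparable with `k j`, fewer than `k j` cycles are completed. -/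
theorem exists_index_lt (hA : 0 < A) (hα : 0 < α)
    (hS : Tendsto (fun k : ℕ => S k / k) atTop (𝓝 A))
    (ht : Tendsto (fun n : ℕ => t n / n) atTop (𝓝 α)) {k : ℕ → ℕ} (hk : Tendsto k atTop atTop) :
    ∃ n : ℕ → ℕ, Tendsto n atTop atTop ∧
      (fun j : ℕ => Real.log (k j) - Real.log (n j)) =O[atTop] (fun _ => (1 : ℝ)) ∧
      ∀ᶠ j in atTop, t (n j) < S (k j) := by
  obtain ⟨D, hD⟩ := exists_nat_gt (4 * α / A)
  rw [div_lt_iff₀ hA] at hD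
  have hD0 : 0 < (D : ℝ) := pos_of_mul_pos_left ((mul_pos four_pos hα).trans hD) hA.le
  have hD1 : 0 < D := by exact_mod_cast hD0
  have hn : Tendsto (fun j => k j / D) atTop atTop :=
    (Nat.tendsto_div_const_atTop hD1.ne').comp hk
  have hle : ∀ j, (D : ℝ) * (k j / D : ℕ) ≤ k j := fun j => by
    exact_mod_cast Nat.mul_div_le (k j) D
  refine ⟨fun j => k j / D, hn, ?_, ?_⟩
  · refine isBigO_log_sub_log_of_comparable (c := D) (C := 2 * D) hD0
      ?_ ?_ ?_ <;> filter_upwards [hn.eventually_ge_atTop 1] with j hj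
    · exact_mod_cast hj
    · exact hle j
    · have h1 : k j ≤ 2 * D * (k j / D) := by
        have := Nat.lt_mul_div_succ (k j) hD1
        nlinarith
      exact_mod_cast h1
  · filter_upwards [hk.eventually (eventually_linear_bounds hA hS),
      hn.eventually (eventually_linear_bounds hα ht), hn.eventually_ge_atTop 1] with j h1 h2 hj
    have hj' : (1 : ℝ) ≤ (k j / D : ℕ) := by exact_mod_cast hj
    have h3 := hle j
    refine h2.2.trans_lt (lt_of_lt_of_le ?_ h1.1)
    nlinarith

end Indices

end RegenExtremes

/-! ### The limsup and liminf statements -/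

open RegenExtremes
theorem proposition1 {Ω : Type*} [MeasurableSpace Ω] (μ : Measure Ω) [IsProbabilityMeasure μ]
    (X : ℝ≥0 → Ω → ℝ) (T : ℕ → Ω → ℝ≥0) (ξ : ℕ → Ω → ℝ≥0 → ℝ)
    (hX : IsRegenerative μ X T ξ)
    (R₀ R₁ : ℝ → ℝ)
    (hR : ∀ x : ℝ, logTail μ X T x = R₀ x + R₁ x)
    (hR₁ : ∃ C₁ : ℝ, ∀ x : ℝ, |R₁ x| ≤ C₁)
    (hR₀ : CondU R₀)
    (hT : Integrable (fun ω => (T 0 ω : ℝ)) μ)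
    (t : ℕ → Ω → ℝ≥0)
    (ht : AttainsExtremes μ X T t)
    (α : ℝ) (hα : 0 < α)
    (htα : ∀ᵐ ω ∂μ, Tendsto (fun n : ℕ => (t n ω : ℝ) / (n : ℝ)) atTop (𝓝 α)) :
    (∀ᵐ ω ∂μ, limsup (fun n : ℕ =>
        ((normalizedMax X t R₀ α (meanCycle μ T) n ω / L₂ n : ℝ) : EReal)) atTop = 1) ∧
    (∀ᵐ ω ∂μ, liminf (fun n : ℕ =>
        ((normalizedMax X t R₀ α (meanCycle μ T) n ω / L₃ n : ℝ) : EReal)) atTop = -1) := by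
  obtain ⟨Z, hZ, hZY⟩ := hX.exists_expTail hR hR₁ hR₀
  obtain ⟨κ, hh⟩ := hR₀.regularlyVarying
  have hg := hR₀.hasDerivAt_genInv
  have hA := hX.meanCycle_pos hT
  set A := meanCycle μ T
  have hb : 0 < α / A := by positivity
  have hnorm : ∀ n ω, normalizedMax X t R₀ α A n ω =
      (discreteMax X t n ω - genInv R₀ (Real.log (α / A * n))) /
        (1 / deriv R₀ (genInv R₀ (Real.log (α / A * n)))) := fun n ω => by
    rw [normalizedMax, centering, mul_div_right_comm, div_div_eq_mul_div, div_one, mul_comm]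
  have hsup : ∀ᵐ ω ∂μ, ∀ q : ℚ,
      (⨆ s : ℝ≥0, ⨆ _ : s ≤ Real.toNNReal q, (X s ω : EReal)) =
        ⨆ i : ℕ, ⨆ _ : t i ω ≤ Real.toNNReal q, (X (t i ω) ω : EReal) :=
    ae_all_iff.2 fun q => ht.sup_eq _
  -- Only countably many δ are used, so one null set serves for all.
  have hδ : ∀ m : ℕ, (0 : ℝ) < 1 / ((m : ℝ) + 1) := fun m => by positivity
  have hsmall : ∀ ε : ℝ, 0 < ε → ∃ m : ℕ, 1 / ((m : ℝ) + 1) < ε :=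
    fun ε hε => exists_nat_one_div_lt hε
  constructor
  · have hup := ae_all_iff.2 fun m : ℕ => hZ.ae_eventually_forall_le (hδ m)
    filter_upwards [hX.eq_path, ht.strictMono, hsup, htα, hX.tendsto_epoch_div hT, hZY, hup,
      hZ.ae_frequently_lt] with ω hpath hmono hsup htα hS hZY hup hlow
    simp only [hZY] at hup hlow
    simp only [hnorm]
    rw [← EReal.coe_one]
    refine limsup_coe_eq (fun r hr => ?_) fun r hr => ?_
    · obtain ⟨m, hm⟩ := hsmall (r - 1) (by linarith)
      obtain ⟨j, hj, hjn, htS⟩ := exists_dyadic_gt hA hα hS htα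
      filter_upwards [hh.eventually_normalized_le hg isLogScale_L₂ hb tendsto_natCast_atTop_atTop
        hjn (show 1 + 1 / ((m : ℝ) + 1) < r by linarith), hj.eventually (hup m), htS]
        with n h1 h2 h3
      exact h1 _ (discreteMax_le hpath hmono (by exact_mod_cast h3) h2)
    · obtain ⟨n, hn, hnk, hSt⟩ := exists_index_ge hA hα hS htα
      have hev := hh.eventually_le_normalized hg isLogScale_L₂ hb
        (tendsto_natCast_atTop_atTop.comp hn) hnk hr
      refine hn.frequently ((hlow.and_eventually (hev.and hSt)).mono ?_)
      rintro k ⟨h1, h2, h3⟩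
      exact h2 _ (le_discreteMax hpath hmono hsup (by exact_mod_cast h3) k.lt_succ_self h1)
  · have hlow := ae_all_iff.2 fun m : ℕ => hZ.ae_eventually_exists_lt (hδ m)
    have hup := ae_all_iff.2 fun m : ℕ => hZ.ae_frequently_forall_le (hδ m)
    filter_upwards [hX.eq_path, ht.strictMono, hsup, htα, hX.tendsto_epoch_div hT, hZY, hup,
      hlow] with ω hpath hmono hsup htα hS hZY hup hlow
    simp only [hZY] at hup hlow
    simp only [hnorm]
    rw [show (-1 : EReal) = ((-1 : ℝ) : EReal) by simp]
    refine liminf_coe_eq (fun r hr => ?_) fun r hr => ?_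
    · obtain ⟨m, hm⟩ := hsmall (-1 - r) (by linarith)
      obtain ⟨j, hj, hjn, htS⟩ := exists_dyadic_le hA hα hS htα
      filter_upwards [hh.eventually_le_normalized hg isLogScale_L₃ hb tendsto_natCast_atTop_atTop
        hjn (show r < -(1 + 1 / ((m : ℝ) + 1)) by linarith), hj.eventually (hlow m), htS]
        with n h1 h2 h3
      obtain ⟨i, hi, h2⟩ := h2
      exact h1 _ (le_discreteMax hpath hmono hsup (by exact_mod_cast h3) hi h2)
    · obtain ⟨m, hm⟩ := hsmall (r + 1) (by linarith)
      have hk : Tendsto (fun j : ℕ => 2 ^ (j ^ 2)) atTop atTop :=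
        (tendsto_pow_atTop_atTop_of_one_lt (one_lt_two (α := ℕ))).comp
          (tendsto_pow_atTop two_ne_zero)
      obtain ⟨n, hn, hnk, htS⟩ := exists_index_lt hA hα hS htα hk
      push_cast at hnk
      have hev := hh.eventually_normalized_le hg isLogScale_L₃ hb
        (tendsto_natCast_atTop_atTop.comp hn) hnk
        (show -(1 - 1 / ((m : ℝ) + 1)) < r by linarith)
      refine hn.frequently (((hup m).and_eventually (hev.and htS)).mono ?_)
      rintro j ⟨h1, h2, h3⟩
      exact h2 _ (discreteMax_le hpath hmono (by exact_mod_cast h3) h1)
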